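/- For integers $0\le 2w\le n$ let $\mathbb{F}_2^{n,w}$ be the binary Johnson space: the set of vectors in $\mathbb{F}_2^n$ with exactly $w$ ones, with the distance $\tau(x,y)=\tfrac12|\{i : x_i\ne y_i\}|$. A finite set $X\subseteq \mathbb{F}_2^{n,w}$ is an $s$-distance set if $|\{\tau(x,y) : x,y\in X,\ x\neq y\}|=s$, and $A(\mathbb{F}_2^{n,w},s)$ denotes the maximum cardinality of an $s$-distance set in $\mathbb{F}_2^{n,w}$. Put $h_0=1$ and $h_i=\binom{n}{i}-\binom{n}{i-1}$ for $i\ge 1$. **Theorem.** 1. For $14\le n\le 58$ and $5\le w\le n/2$ we have $$A(\mathbb{F}_2^{n,w},4)\le h_0+h_1+h_2+h_4=\binom n4-\binom n3+\binom n2 .$$ 2. If $n$ and $w$ satisfy any of the following conditions: - $15\le n\le 16$ and $w=5$; - $17\le n\le 19$ and $5\le w\le 6$; - $20\le n\le 24$ and $5\le w\le 7$; - $25\le n\le 29$ and $5\le w\le 8$; - ($30\le n\le 34$ or $41\le n\le 47$) and $5\le w\le 9$; - ($35\le n\le 40$ or $48\le n\le 59$) and $5\le w\le 10$; - $60\le n\le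 70$ and $5\le w\le 11$; then $A(\mathbb{F}_2^{n,w},4)=\binom{n-w+4}{4}$. -/

import Mathlib

/-- The distance set `D(X) = {τ(x, y) | x, y ∈ X, x ≠ y}` of a finite subset `X` of a metric
space `M`. -/
def distanceSet {M : Type*} [MetricSpace M] (X : Finset M) : Set ℝ :=
  {t | ∃ x ∈ X, ∃ y ∈ X, x ≠ y ∧ dist x y = t}

/-- `X` is an `s`-distance set: exactly `s` distances occur between distinct points of `X`. -/
def IsSDistanceSet {M : Type*} [MetricSpace M] (s : ℕ) (X : Finset M) : Prop :=
  (distanceSet X).ncard = s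

/-- `A(M, s)`: the maximum cardinality of an `s`-distance set in `M`. For finite `M` this is a true
maximum as soon as an `s`-distance set exists, see `isGreatest_maxSDistance`. -/
noncomputable def maxSDistance (M : Type*) [MetricSpace M] (s : ℕ) : ℕ :=
  sSup {k : ℕ | ∃ X : Finset M, IsSDistanceSet s X ∧ X.card = k}

theorem distanceSet_finite {M : Type*} [MetricSpace M] (X : Finset M) :
    (distanceSet X).Finite := by
  refine ((X ×ˢ X).finite_toSet.image (fun p => dist p.1 p.2)).subset ?_
  rintro t ⟨x, hx, y, hy, -, rfl⟩
  exact ⟨(x, y), by simp [hx, hy], rfl⟩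

theorem isGreatest_maxSDistance {M : Type*} [MetricSpace M] [Finite M] {s : ℕ}
    (h : ∃ X : Finset M, IsSDistanceSet s X) :
    IsGreatest {k : ℕ | ∃ X : Finset M, IsSDistanceSet s X ∧ X.card = k} (maxSDistance M s) := by
  have : Fintype M := Fintype.ofFinite M
  have hb : BddAbove {k : ℕ | ∃ X : Finset M, IsSDistanceSet s X ∧ X.card = k} :=
    ⟨Fintype.card M, by rintro k ⟨X, -, rfl⟩; exact X.card_le_univ⟩
  obtain ⟨X, hX⟩ := h
  exact ⟨Nat.sSup_mem ⟨X.card, X, hX, rfl⟩ hb, fun k hk => le_csSup hb hk⟩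

/-- The binary Johnson space `𝔽₂^{n,w}`: binary vectors of length `n` with exactly `w` ones. -/
def JohnsonSpace (n w : ℕ) : Type :=
  {x : Fin n → ZMod 2 // (Finset.univ.filter fun i => x i = 1).card = w}

/-- The distance on the Johnson space is half the number of coordinates in which two vectors
differ (`hammingDist x y` is the number of `i` with `x i ≠ y i`). -/
noncomputable instance (n w : ℕ) : MetricSpace (JohnsonSpace n w) where
  dist x y := (hammingDist x.1 y.1 : ℝ) / 2
  dist_self x := by simp
  dist_comm x y := by rw [hammingDist_comm]
  dist_triangle x y z := by
    have h : (hammingDist x.1 z.1 : ℝ) ≤ hammingDist x.1 y.1 + hammingDist y.1 z.1 := by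
      exact_mod_cast hammingDist_triangle x.1 y.1 z.1
    linarith
  eq_of_dist_eq_zero {x y} h := by
    have h' : (hammingDist x.1 y.1 : ℝ) / 2 = 0 := h
    have h0 : hammingDist x.1 y.1 = 0 := by
      have : (hammingDist x.1 y.1 : ℝ) = 0 := by linarith
      exact_mod_cast this
    exact Subtype.ext (hammingDist_eq_zero.mp h0)

instance (n w : ℕ) : Finite (JohnsonSpace n w) :=
  inferInstanceAs (Finite {x : Fin n → ZMod 2 // (Finset.univ.filter fun i => x i = 1).card = w})

/-- The numbers `h_0 = 1` and `h_i = C(n, i) - C(n, i - 1)` of the Johnson space, as integers. -/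
def johnsonH (n : ℕ) : ℕ → ℤ
  | 0 => 1
  | i + 1 => (n.choose (i + 1) : ℤ) - (n.choose i : ℤ)

/-! Identify vectors with their supports, so that points are `w`-subsets of an `n`-set at distance
`|x \ y|`. Let `A` be a family with four distances `a < b < c < d ≤ w`, and suppose that it exceeds
the claimed bound.

In all ranges considered that bound is at least `C(n, 3)`, so the argument of Larman, Rogers and
Seidel applies (`dvd_of_choose_three_lt_card`): a nonzero weight on `A` is annihilated by every
cubic in the distance, hence is an eigenvector of each of the four 0/1 distance matrices. The
eigenvalues, such as `abc / ((d - a)(d - b)(d - c))`, must be integers. This leaves a finite list of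
quadruples, each excluded by one of two bounds.

The usual polynomial bound is `C(n, 4) = h_0 + ... + h_4`. If the annihilator `∏ (a_i - t)` has a
nonpositive coefficient at the Hahn polynomial of degree three, then `h_3` can be dropped
(`card_add_choose_three_le`). The other bound is Delsarte's linear programming bound
(`card_le_of_hahnSum`). It rests on the Hahn polynomials being positive semidefinite kernels
(`harmonicKernel_nonneg`) and uses explicit weights checked in integer arithmetic. Padding with ones
and zeros lets one certificate serve many pairs `(n, w)`.

For the second claim only linear programming is used. The family of sets through `w - 4` fixed
points attains the bound; its own distances `1, 2, 3, 4` require weights adapted to it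
(`anticodeCoeffs`). -/

/-! ### Positive semidefinite kernels and Hahn polynomials -/

/-- The kernel `∑ ∏ i, (x_{a i} - x_{b i}) (y_{a i} - y_{b i})`, summed over all sequences of `j`
disjoint pairs `(a i, b i)` of points of `U`. -/
def harmonicKernel {α : Type*} [DecidableEq α] :
    ℕ → Finset α → Finset α → Finset α → ℤ
  | 0, _, _, _ => 1
  | j + 1, U, x, y => ∑ a ∈ U, ∑ b ∈ U.erase a,
      ((if a ∈ x then 1 else 0) - (if b ∈ x then 1 else 0)) *
        ((if a ∈ y then 1 else 0) - (if b ∈ y then 1 else 0)) *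
          harmonicKernel j ((U.erase a).erase b) x y

/-- For a fixed sequence of pairs the product is a function of `x` times the same function of `y`,
so the form is a sum of squares. The induction absorbs the factor of one pair into the weight `c`.
-/
theorem harmonicKernel_nonneg {α : Type*} [DecidableEq α] (A : Finset (Finset α)) (j : ℕ)
    (U : Finset α) (c : Finset α → ℤ) :
    0 ≤ ∑ x ∈ A, ∑ y ∈ A, c x * c y * harmonicKernel j U x y := by
  induction j generalizing U c with
  | zero =>
    simp only [harmonicKernel, mul_one, ← Finset.mul_sum, ← Finset.sum_mul]
    exact mul_self_nonneg _
  | succ j ih =>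
    have h : ∑ x ∈ A, ∑ y ∈ A, c x * c y * harmonicKernel (j + 1) U x y
        = ∑ a ∈ U, ∑ b ∈ U.erase a, ∑ x ∈ A, ∑ y ∈ A,
          (c x * ((if a ∈ x then 1 else 0) - (if b ∈ x then 1 else 0))) *
          (c y * ((if a ∈ y then 1 else 0) - (if b ∈ y then 1 else 0))) *
          harmonicKernel j ((U.erase a).erase b) x y := by
      simp only [harmonicKernel, Finset.mul_sum]
      calc _ = ∑ x ∈ A, ∑ a ∈ U, ∑ b ∈ U.erase a, ∑ y ∈ A,
          (c x * ((if a ∈ x then 1 else 0) - (if b ∈ x then 1 else 0))) *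
          (c y * ((if a ∈ y then 1 else 0) - (if b ∈ y then 1 else 0))) *
          harmonicKernel j ((U.erase a).erase b) x y := by
            refine Finset.sum_congr rfl fun x _ => ?_
            rw [Finset.sum_comm]
            refine Finset.sum_congr rfl fun a _ => ?_
            rw [Finset.sum_comm]
            refine Finset.sum_congr rfl fun b _ => Finset.sum_congr rfl fun y _ => ?_
            ring
        _ = _ := by
            rw [Finset.sum_comm]
            refine Finset.sum_congr rfl fun a _ => ?_
            rw [Finset.sum_comm]
    rw [h]
    exact Finset.sum_nonneg fun a _ => Finset.sum_nonneg fun b _ => ih _ _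

/-- The value of the harmonic kernel (up to the factor `2 ^ j`) on a pair of sets in terms of the
sizes of the four cells of their Venn diagram: an unnormalized Hahn polynomial. -/
def hahnRec : ℕ → ℕ → ℕ → ℕ → ℕ → ℤ
  | 0, _, _, _, _ => 1
  | j + 1, p, s, t, r =>
      p * r * hahnRec j (p - 1) s t (r - 1) - s * t * hahnRec j p (s - 1) (t - 1) r

/-- A pair contributes only if both `x` and `y` separate its points: with sign `+` if one point is
in `x ∩ y` and the other outside `x ∪ y`, with sign `-` if one is in `x \ y` and the other in `y \
x`. The factor `2` counts the two orders. -/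
theorem sum_sum_eq_of_cells {α : Type*} [DecidableEq α] (U x y : Finset α) (f : α → α → ℤ)
    (A B : ℤ)
    (hA : ∀ a ∈ U ∩ (x ∩ y), ∀ b ∈ U \ (x ∪ y), f a b = A ∧ f b a = A)
    (hB : ∀ a ∈ U ∩ (x \ y), ∀ b ∈ U ∩ (y \ x), f a b = B ∧ f b a = B) :
    ∑ a ∈ U, ∑ b ∈ U.erase a,
      (((if a ∈ x then 1 else 0) - (if b ∈ x then 1 else 0)) *
        ((if a ∈ y then 1 else 0) - (if b ∈ y then 1 else 0)) * f a b : ℤ)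
      = 2 * ((U ∩ (x ∩ y)).card * (U \ (x ∪ y)).card * A
          - (U ∩ (x \ y)).card * (U ∩ (y \ x)).card * B) := by
  have key : ∀ a ∈ U, ∀ b ∈ U,
      (((if a ∈ x then 1 else 0) - (if b ∈ x then 1 else 0)) *
        ((if a ∈ y then 1 else 0) - (if b ∈ y then 1 else 0)) * f a b : ℤ)
      = (if a ∈ x ∩ y then 1 else 0) * (if b ∉ x ∪ y then 1 else 0) * A
        + (if a ∉ x ∪ y then 1 else 0) * (if b ∈ x ∩ y then 1 else 0) * A
        - (if a ∈ x \ y then 1 else 0) * (if b ∈ y \ x then 1 else 0) * B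
        - (if a ∈ y \ x then 1 else 0) * (if b ∈ x \ y then 1 else 0) * B := by
    intro a ha b hb
    have h1 := hA a
    have h2 := hA b
    have h3 := hB a
    have h4 := hB b
    simp only [Finset.mem_inter, Finset.mem_sdiff, Finset.mem_union, ha, hb, true_and]
      at h1 h2 h3 h4 ⊢
    by_cases hax : a ∈ x <;> by_cases hay : a ∈ y <;> by_cases hbx : b ∈ x <;>
      by_cases hby : b ∈ y <;> simp only [hax, hay, hbx, hby] at h1 h2 h3 h4 ⊢ <;> simp
    · exact (h1 ⟨trivial, trivial⟩ b ⟨hb, by simp [hbx, hby]⟩).1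
    · rw [(h3 ⟨trivial, by simp⟩ b ⟨hb, by simp [hbx, hby]⟩).1]
    · rw [(h4 ⟨trivial, by simp⟩ a ⟨ha, by simp [hax, hay]⟩).2]
    · exact (h2 ⟨trivial, trivial⟩ a ⟨ha, by simp [hax, hay]⟩).2
  have h0 : ∑ a ∈ U, ∑ b ∈ U.erase a,
      (((if a ∈ x then 1 else 0) - (if b ∈ x then 1 else 0)) *
        ((if a ∈ y then 1 else 0) - (if b ∈ y then 1 else 0)) * f a b : ℤ)
      = ∑ a ∈ U, ∑ b ∈ U,
      (((if a ∈ x then 1 else 0) - (if b ∈ x then 1 else 0)) *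
        ((if a ∈ y then 1 else 0) - (if b ∈ y then 1 else 0)) * f a b : ℤ) := by
    refine Finset.sum_congr rfl fun a ha => ?_
    exact Finset.sum_erase _ (by simp)
  rw [h0, Finset.sum_congr rfl fun a ha => Finset.sum_congr rfl fun b hb => key a ha b hb]
  have e1 : ∀ V : Finset α, ∑ a ∈ U, (if a ∈ V then 1 else 0 : ℤ) = (U ∩ V).card := by
    intro V
    rw [Finset.sum_boole, Finset.filter_mem_eq_inter]
  have e2 : ∑ a ∈ U, (if a ∉ x ∪ y then 1 else 0 : ℤ) = (U \ (x ∪ y)).card := by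
    rw [Finset.sum_boole, ← Finset.sdiff_eq_filter]
  simp only [Finset.sum_add_distrib, Finset.sum_sub_distrib, ← Finset.sum_mul, ← Finset.mul_sum,
    e1, e2]
  ring

theorem harmonicKernel_eq {α : Type*} [DecidableEq α] (j : ℕ) (U x y : Finset α) :
    harmonicKernel j U x y = 2 ^ j * hahnRec j (U ∩ (x ∩ y)).card (U ∩ (x \ y)).card
      (U ∩ (y \ x)).card (U \ (x ∪ y)).card := by
  induction j generalizing U with
  | zero => simp [harmonicKernel, hahnRec]
  | succ j ih =>
    rw [harmonicKernel, sum_sum_eq_of_cells U x y _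
      (2 ^ j * hahnRec j ((U ∩ (x ∩ y)).card - 1) (U ∩ (x \ y)).card
        (U ∩ (y \ x)).card ((U \ (x ∪ y)).card - 1))
      (2 ^ j * hahnRec j (U ∩ (x ∩ y)).card ((U ∩ (x \ y)).card - 1)
        ((U ∩ (y \ x)).card - 1) (U \ (x ∪ y)).card)]
    · rw [hahnRec]; ring
    · intro a ha b hb
      simp only [Finset.mem_inter, Finset.mem_sdiff, Finset.mem_union, not_or] at ha hb
      have c1 : ((U.erase a).erase b) ∩ (x ∩ y) = (U ∩ (x ∩ y)).erase a := by
        ext z; simp only [Finset.mem_inter, Finset.mem_erase]; grind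
      have c2 : ((U.erase a).erase b) ∩ (x \ y) = (U ∩ (x \ y)) := by
        ext z; simp only [Finset.mem_inter, Finset.mem_erase, Finset.mem_sdiff]; grind
      have c3 : ((U.erase a).erase b) ∩ (y \ x) = (U ∩ (y \ x)) := by
        ext z; simp only [Finset.mem_inter, Finset.mem_erase, Finset.mem_sdiff]; grind
      have c4 : ((U.erase a).erase b) \ (x ∪ y) = (U \ (x ∪ y)).erase b := by
        ext z; simp only [Finset.mem_sdiff, Finset.mem_erase, Finset.mem_union]; grind
      have : harmonicKernel j ((U.erase a).erase b) x y = 2 ^ j * hahnRec j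
          ((U ∩ (x ∩ y)).card - 1) (U ∩ (x \ y)).card (U ∩ (y \ x)).card
          ((U \ (x ∪ y)).card - 1) := by
        rw [ih, c1, c2, c3, c4, Finset.card_erase_of_mem (by simp; tauto),
          Finset.card_erase_of_mem (by simp; tauto)]
      exact ⟨this, by rw [Finset.erase_right_comm, this]⟩
    · intro a ha b hb
      simp only [Finset.mem_inter, Finset.mem_sdiff] at ha hb
      have c1 : ((U.erase a).erase b) ∩ (x ∩ y) = (U ∩ (x ∩ y)) := by
        ext z; simp only [Finset.mem_inter, Finset.mem_erase]; grind
      have c2 : ((U.erase a).erase b) ∩ (x \ y) = (U ∩ (x \ y)).erase a := by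
        ext z; simp only [Finset.mem_inter, Finset.mem_erase, Finset.mem_sdiff]; grind
      have c3 : ((U.erase a).erase b) ∩ (y \ x) = (U ∩ (y \ x)).erase b := by
        ext z; simp only [Finset.mem_inter, Finset.mem_erase, Finset.mem_sdiff]; grind
      have c4 : ((U.erase a).erase b) \ (x ∪ y) = (U \ (x ∪ y)) := by
        ext z; simp only [Finset.mem_sdiff, Finset.mem_erase, Finset.mem_union]; grind
      have : harmonicKernel j ((U.erase a).erase b) x y = 2 ^ j * hahnRec j
          (U ∩ (x ∩ y)).card ((U ∩ (x \ y)).card - 1) ((U ∩ (y \ x)).card - 1)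
          (U \ (x ∪ y)).card := by
        rw [ih, c1, c2, c3, c4, Finset.card_erase_of_mem (by simp; tauto),
          Finset.card_erase_of_mem (by simp; tauto)]
      exact ⟨this, by rw [Finset.erase_right_comm, this]⟩

/-- Unfolding the recursion chooses one of its two terms `j` times, and the order of the choices
does not affect the product; hence the binomial coefficient. In the induction this is Pascal's rule.
-/
theorem hahnRec_eq_sum (j p s t r : ℕ) :
    hahnRec j p s t r = ∑ i ∈ Finset.range (j + 1), (-1) ^ i * (j.choose i : ℤ) *
      (s.descFactorial i * t.descFactorial i) *
      (p.descFactorial (j - i) * r.descFactorial (j - i)) := by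
  induction j generalizing p s t r with
  | zero => simp [hahnRec]
  | succ j ih =>
    -- The truncated `m - 1` is harmless at `m = 0`, where both sides vanish.
    have hd : ∀ m k : ℕ, (m.descFactorial (k + 1) : ℤ) = m * (m - 1).descFactorial k := by
      intro m k
      cases m with
      | zero => simp
      | succ m => rw [Nat.succ_descFactorial_succ]; push_cast; simp
    rw [hahnRec, ih, ih, Finset.mul_sum, Finset.mul_sum]
    have e1 : ∀ i ∈ Finset.range (j + 1),
        (p : ℤ) * r * ((-1) ^ i * (j.choose i : ℤ) * (s.descFactorial i * t.descFactorial i) *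
          ((p - 1).descFactorial (j - i) * (r - 1).descFactorial (j - i)))
        = (-1) ^ i * (j.choose i : ℤ) * (s.descFactorial i * t.descFactorial i) *
          (p.descFactorial (j + 1 - i) * r.descFactorial (j + 1 - i)) := by
      intro i hi
      have : j + 1 - i = (j - i) + 1 := by
        have := Finset.mem_range.1 hi; omega
      rw [this, hd, hd]; ring
    have e2 : ∀ i ∈ Finset.range (j + 1),
        (s : ℤ) * t * ((-1) ^ i * (j.choose i : ℤ) *
          ((s - 1).descFactorial i * (t - 1).descFactorial i) *
          (p.descFactorial (j - i) * r.descFactorial (j - i)))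
        = - ((-1) ^ (i + 1) * (j.choose i : ℤ) *
          (s.descFactorial (i + 1) * t.descFactorial (i + 1)) *
          (p.descFactorial (j + 1 - (i + 1)) * r.descFactorial (j + 1 - (i + 1)))) := by
      intro i _
      rw [hd, hd, Nat.add_sub_add_right]; ring
    rw [Finset.sum_congr rfl e1, Finset.sum_congr rfl e2, Finset.sum_neg_distrib, sub_neg_eq_add]
    rw [Finset.sum_range_succ' _ (j + 1)]
    simp only [Nat.choose_succ_succ, Nat.cast_add, mul_add, add_mul, Finset.sum_add_distrib]
    have e3 : ∑ i ∈ Finset.range (j + 1),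
        (-1) ^ i * (j.choose i : ℤ) * (s.descFactorial i * t.descFactorial i) *
          (p.descFactorial (j + 1 - i) * r.descFactorial (j + 1 - i))
        = ∑ i ∈ Finset.range (j + 1), (-1) ^ (i + 1) * (j.choose (i + 1) : ℤ) *
          (s.descFactorial (i + 1) * t.descFactorial (i + 1)) *
          (p.descFactorial (j + 1 - (i + 1)) * r.descFactorial (j + 1 - (i + 1)))
          + (p.descFactorial (j + 1) * r.descFactorial (j + 1)) := by
      rw [Finset.sum_range_succ', Finset.sum_range_succ (n := j) (f := fun i =>
        (-1) ^ (i + 1) * (j.choose (i + 1) : ℤ) *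
          (s.descFactorial (i + 1) * t.descFactorial (i + 1)) *
          (p.descFactorial (j + 1 - (i + 1)) * r.descFactorial (j + 1 - (i + 1))))]
      simp
    rw [e3]
    simp
    ring

/-! ### Fast evaluation of Hahn polynomials -/

/-- The list `[(p)_k (r)_k, …, (p)_1 (r)_1, 1]` of products of falling factorials. -/
def descFactorialProducts (p r : ℕ) : ℕ → List ℕ
  | 0 => [1]
  | k + 1 => match descFactorialProducts p r k with
    | [] => []
    | v :: l => v * ((p - k) * (r - k)) :: v :: l

/-- Alternating sum of the entries of a list, with weights `C(j, i) (s)_i ^ 2` that are updated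
on the way. -/
def alternatingHahnSum (j s : ℕ) : List ℕ → ℕ → ℕ → ℤ
  | [], _, _ => 0
  | v :: l, i, d =>
    Int.subNatNat (d * v) 0 -
      alternatingHahnSum j s l (i + 1) (d * ((j - i) * ((s - i) * (s - i))) / (i + 1))

/-- An evaluation of `hahnRec j p s s r` in linear time. -/
def hahnEval (j p s r : ℕ) : ℤ :=
  alternatingHahnSum j s (descFactorialProducts p r j) 0 1

theorem descFactorialProducts_succ (p r k : ℕ) :
    descFactorialProducts p r (k + 1)
      = p.descFactorial (k + 1) * r.descFactorial (k + 1) :: descFactorialProducts p r k := by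
  induction k with
  | zero => simp [descFactorialProducts]
  | succ k ih =>
    rw [descFactorialProducts, ih]
    simp only [Nat.descFactorial_succ, List.cons.injEq, and_true]
    ring

theorem alternatingHahnSum_eq (j s p r k i : ℕ) (h : i + k = j) :
    alternatingHahnSum j s (descFactorialProducts p r k) i
        (j.choose i * (s.descFactorial i * s.descFactorial i))
      = ∑ m ∈ Finset.range (k + 1), (-1) ^ m * (j.choose (i + m) : ℤ) *
        (s.descFactorial (i + m) * s.descFactorial (i + m)) *
        (p.descFactorial (k - m) * r.descFactorial (k - m)) := by
  induction k generalizing i with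
  | zero => simp [descFactorialProducts, alternatingHahnSum, Int.subNatNat_eq_coe]
  | succ k ih =>
    have hdiv : j.choose i * (s.descFactorial i * s.descFactorial i) *
        ((j - i) * ((s - i) * (s - i))) / (i + 1)
        = j.choose (i + 1) * (s.descFactorial (i + 1) * s.descFactorial (i + 1)) := by
      -- The division is exact because `C(j, i) (j - i) = C(j, i + 1) (i + 1)`.
      apply Nat.div_eq_of_eq_mul_left (Nat.succ_pos i)
      have := Nat.choose_succ_right_eq j i
      simp only [Nat.descFactorial_succ]
      calc _ = (j.choose i * (j - i)) * (s.descFactorial i * s.descFactorial i)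
            * ((s - i) * (s - i)) := by ring
        _ = _ := by rw [← this]; simp only [Nat.succ_eq_add_one]; ring
    rw [descFactorialProducts_succ, alternatingHahnSum, hdiv, ih (i + 1) (by omega),
      Finset.sum_range_succ' _ (k + 1), sub_eq_add_neg, ← Finset.sum_neg_distrib, add_comm]
    congr 1
    · refine Finset.sum_congr rfl fun m _ => ?_
      rw [show i + (m + 1) = i + 1 + m by ring, Nat.add_sub_add_right]
      ring
    · simp [Int.subNatNat_eq_coe]

theorem hahnEval_eq (j p s r : ℕ) : hahnEval j p s r = hahnRec j p s s r := by
  rw [hahnRec_eq_sum, hahnEval]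
  have := alternatingHahnSum_eq j s p r j 0 (by simp)
  simpa using this

/-! ### The linear programming bound -/

/-- The combination `∑ c_j Q_j(t)` of unnormalized Hahn polynomials of the Johnson space with
parameters `n`, `w`, for a list of pairs `(j, c_j)`. -/
def hahnSum (n w t : ℕ) : List (ℕ × ℕ) → ℤ
  | [] => 0
  | jc :: l => Int.subNatNat jc.2 0 * hahnEval jc.1 (w - t) t (n - w - t) + hahnSum n w t l

/-- This is semidefiniteness tested on the constant vector. Since all members have `w` points, the
four Venn cells of a pair depend only on `|x \ y|`. -/
theorem hahnSum_nonneg {α : Type*} [Fintype α] [DecidableEq α] {A : Finset (Finset α)} {w : ℕ}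
    (hA : ∀ x ∈ A, x.card = w) (l : List (ℕ × ℕ)) :
    0 ≤ ∑ x ∈ A, ∑ y ∈ A, hahnSum (Fintype.card α) w (x \ y).card l := by
  induction l with
  | nil => simp [hahnSum]
  | cons jc l ih =>
    simp only [hahnSum, Finset.sum_add_distrib, ← Finset.mul_sum]
    refine add_nonneg (mul_nonneg (by simp [Int.subNatNat_eq_coe]) ?_) ih
    have h := harmonicKernel_nonneg A jc.1 Finset.univ (fun _ => 1)
    have e : ∀ x ∈ A, ∀ y ∈ A, (1 : ℤ) * 1 * harmonicKernel jc.1 Finset.univ x y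
        = 2 ^ jc.1 * hahnEval jc.1 (w - (x \ y).card) (x \ y).card
          (Fintype.card α - w - (x \ y).card) := by
      intro x hx y hy
      have h1 : (y \ x).card = (x \ y).card := Finset.card_sdiff_comm ((hA y hy).trans (hA x hx).symm)
      have h2 := Finset.card_inter_add_card_sdiff x y
      have h3 := Finset.card_union_add_card_inter x y
      have h4 : (x ∪ y)ᶜ.card = Fintype.card α - (x ∪ y).card := Finset.card_compl _
      have hx' := hA x hx
      have hy' := hA y hy
      rw [harmonicKernel_eq, hahnEval_eq]
      simp only [Finset.univ_inter, h1, ← Finset.compl_eq_univ_sdiff]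
      rw [h4, show (x ∩ y).card = w - (x \ y).card by omega,
        show Fintype.card α - (x ∪ y).card = Fintype.card α - w - (x \ y).card by omega]
      ring
    rw [Finset.sum_congr rfl fun x hx => Finset.sum_congr rfl fun y hy => e x hx y hy] at h
    simp only [← Finset.mul_sum] at h
    exact nonneg_of_mul_nonneg_right h (by positivity)

/-- Delsarte's linear programming bound. -/
theorem card_le_of_hahnSum {α : Type*} [Fintype α] [DecidableEq α] {A : Finset (Finset α)} {w : ℕ}
    (hA : ∀ x ∈ A, x.card = w) (l : List (ℕ × ℕ)) {b : ℕ} (hb : 0 < b)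
    (h : ∀ x ∈ A, ∀ y ∈ A, x ≠ y → b * hahnSum (Fintype.card α) w (x \ y).card l
      + hahnSum (Fintype.card α) w 0 l < 0) :
    A.card ≤ b := by
  by_contra! hlt
  set F := fun t => hahnSum (Fintype.card α) w t l with hF
  have hS := hahnSum_nonneg hA l
  obtain ⟨x₀, hx₀⟩ : A.Nonempty := Finset.card_pos.1 (by omega)
  have h0 : 0 ≤ F 0 := by
    have := hahnSum_nonneg (A := {x₀}) (w := w) (by simpa using hA x₀ hx₀) l
    simpa using this
  -- Off the diagonal the summands are at most zero, being integers with `b * F t + F 0 < 0`. Adding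
  -- all rows and discarding the nonnegative double sum of `F` gives `|A| ((|A| - 1 - b) F 0 + |A| -
  -- 1) ≤ 0`, which is impossible for `|A| ≥ b + 1 ≥ 2`.
  have hrow : ∀ x ∈ A, ∑ y ∈ A, (b * F (x \ y).card + F 0 + 1) ≤ b * F 0 + F 0 + 1 := by
    intro x hx
    rw [← Finset.add_sum_erase A _ hx]
    have : ∑ y ∈ A.erase x, (b * F (x \ y).card + F 0 + 1) ≤ 0 :=
      Finset.sum_nonpos fun y hy => by
        have := h x hx y (Finset.mem_of_mem_erase hy) (Finset.ne_of_mem_erase hy).symm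
        simp only [hF]; omega
    simp only [Finset.sdiff_self, Finset.card_empty]
    linarith
  have hsum := Finset.sum_le_sum hrow
  simp only [Finset.sum_add_distrib, Finset.sum_const, nsmul_eq_mul, ← Finset.mul_sum] at hsum
  have hv : (b : ℤ) + 1 ≤ A.card := by exact_mod_cast hlt
  have hb' : (0 : ℤ) < b := by exact_mod_cast hb
  have hS' : 0 ≤ (b : ℤ) * ∑ x ∈ A, ∑ y ∈ A, F (x \ y).card := mul_nonneg hb'.le hS
  have hv0 : (0 : ℤ) < A.card := by linarith
  have : (A.card : ℤ) * ((A.card - 1 - b) * F 0 + (A.card - 1)) ≤ 0 := by linarith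
  have h2 : 0 < ((A.card : ℤ) - 1 - b) * F 0 + (A.card - 1) := by
    have : 0 ≤ ((A.card : ℤ) - 1 - b) * F 0 := mul_nonneg (by linarith) h0
    linarith
  nlinarith [mul_pos hv0 h2]

/-- The linear programming bound in a larger Johnson space, into which the given one embeds. -/
theorem card_le_of_hahnSum_of_le {n w n' w' : ℕ} {A : Finset (Finset (Fin n))}
    (hA : ∀ x ∈ A, x.card = w) (hw : w ≤ w') (hn : n + w' ≤ n' + w)
    (l : List (ℕ × ℕ)) {b : ℕ} (hb : 0 < b)
    (h : ∀ x ∈ A, ∀ y ∈ A, x ≠ y →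
      b * hahnSum n' w' (x \ y).card l + hahnSum n' w' 0 l < 0) :
    A.card ≤ b := by
  -- The first block of padding points is added to every set, the second lies outside all of them;
  -- set differences do not change.
  let u : Finset (Fin (w' - w) ⊕ Fin (n' + w - n - w')) := Finset.univ.disjSum ∅
  have hu : u.card = w' - w := by simp [u]
  have hcard : Fintype.card (Fin n ⊕ (Fin (w' - w) ⊕ Fin (n' + w - n - w'))) = n' := by
    simp; omega
  let φ : Finset (Fin n) ↪ Finset (Fin n ⊕ (Fin (w' - w) ⊕ Fin (n' + w - n - w'))) :=
    ⟨fun x => x.disjSum u, fun x y hxy => by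
      ext a
      have := congrArg (fun s => Sum.inl a ∈ s) hxy
      simpa using this⟩
  have hφ : ∀ x, φ x = x.disjSum u := fun _ => rfl
  have hsd : ∀ x y, (φ x \ φ y).card = (x \ y).card := by
    intro x y
    have : φ x \ φ y = (x \ y).map Function.Embedding.inl := by
      ext a
      cases a <;> simp [hφ]
    rw [this, Finset.card_map]
  rw [← Finset.card_map φ]
  refine card_le_of_hahnSum (w := w') ?_ l hb ?_
  · intro x hx
    obtain ⟨y, hy, rfl⟩ := Finset.mem_map.1 hx
    rw [hφ, Finset.card_disjSum, hu, hA y hy]; omega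
  · intro x' hx' y' hy' hxy
    obtain ⟨x, hx, rfl⟩ := Finset.mem_map.1 hx'
    obtain ⟨y, hy, rfl⟩ := Finset.mem_map.1 hy'
    rw [hsd, hcard]
    exact h x hx y hy fun e => hxy (by rw [e])

/-! ### Linear algebra and inclusion operators -/

theorem exists_ne_zero_sum_eq_zero {ι κ : Type*} [DecidableEq ι] [DecidableEq κ]
    (I : Finset ι) (K : Finset κ) (M : κ → ι → ℚ) (h : K.card < I.card) :
    ∃ c : ι → ℚ, (∃ i ∈ I, c i ≠ 0) ∧ (∀ i, i ∉ I → c i = 0) ∧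
      ∀ k ∈ K, ∑ i ∈ I, c i * M k i = 0 := by
  have hker := LinearMap.ker_ne_bot_of_finrank_lt
    (f := Matrix.mulVecLin (Matrix.of fun (k : K) (i : I) => M k i)) (by simpa using h)
  obtain ⟨v, hv, hv0⟩ := (Submodule.ne_bot_iff _).1 hker
  obtain ⟨i, hi⟩ := Function.ne_iff.1 hv0
  refine ⟨fun i => if hi : i ∈ I then v ⟨i, hi⟩ else 0, ⟨i, i.2, by simpa using hi⟩,
    fun i hi => by simp [hi], fun k hk => ?_⟩
  have := congrFun (LinearMap.mem_ker.1 hv) ⟨k, hk⟩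
  rw [← Finset.sum_coe_sort I]
  simpa [Matrix.mulVec, dotProduct, mul_comm] using this

/-- A rational eigenvalue is a root of the monic integral characteristic polynomial, and `ℤ` is
integrally closed. -/
theorem exists_int_of_mulVec_eq_smul {ι : Type*} [Fintype ι] [DecidableEq ι] (M : Matrix ι ι ℤ)
    {v : ι → ℚ} (hv : v ≠ 0) {q : ℚ} (h : (M.map ((↑) : ℤ → ℚ)).mulVec v = q • v) :
    ∃ k : ℤ, (k : ℚ) = q := by
  have hdet : (Matrix.scalar ι q - M.map ((↑) : ℤ → ℚ)).det = 0 := by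
    rw [← Matrix.exists_mulVec_eq_zero_iff]
    refine ⟨v, hv, ?_⟩
    rw [Matrix.sub_mulVec, h]
    ext i
    simp
  have hroot : (M.charpoly.map (Int.castRingHom ℚ)).eval q = 0 := by
    rw [← Matrix.charpoly_map, Matrix.eval_charpoly]
    exact hdet
  rw [Polynomial.eval_map] at hroot
  exact IsIntegrallyClosed.isIntegral_iff.1 ⟨M.charpoly, M.charpoly_monic, hroot⟩

/-- The weight of the members of `A` that contain `T`. -/
def coverWeight {α : Type*} [DecidableEq α] (A : Finset (Finset α)) (c : Finset α → ℚ)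
    (T : Finset α) : ℚ :=
  ∑ x ∈ A, if T ⊆ x then c x else 0

/-- The adjoint of `downSum`. -/
def upSum {α : Type*} [DecidableEq α] (f : Finset α → ℚ) (S : Finset α) : ℚ :=
  ∑ a ∈ S, f (S.erase a)

/-- The sum of the values at the sets that cover `T`. -/
def downSum {α : Type*} [Fintype α] [DecidableEq α] (f : Finset α → ℚ) (T : Finset α) : ℚ :=
  ∑ a ∈ Tᶜ, f (insert a T)

/-- Both sides sum over the pairs `T ⊂ S` that differ in one point. -/
theorem sum_mul_upSum {α : Type*} [Fintype α] [DecidableEq α] (f g : Finset α → ℚ) (k : ℕ) :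
    ∑ S ∈ Finset.univ.powersetCard (k + 1), g S * upSum f S
      = ∑ T ∈ Finset.univ.powersetCard k, downSum g T * f T := by
  simp only [upSum, downSum, Finset.mul_sum, Finset.sum_mul]
  rw [Finset.sum_sigma', Finset.sum_sigma']
  refine Finset.sum_bij' (fun p _ => ⟨p.1.erase p.2, p.2⟩) (fun p _ => ⟨insert p.2 p.1, p.2⟩)
    ?_ ?_ ?_ ?_ ?_
  · rintro ⟨S, a⟩ h
    simp only [Finset.mem_sigma, Finset.mem_powersetCard, Finset.subset_univ, true_and] at h ⊢
    rw [Finset.card_erase_of_mem h.2, h.1]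
    simp
  · rintro ⟨T, a⟩ h
    simp only [Finset.mem_sigma, Finset.mem_powersetCard, Finset.subset_univ, true_and,
      Finset.mem_compl] at h ⊢
    rw [Finset.card_insert_of_notMem h.2, h.1]
    simp
  · rintro ⟨S, a⟩ h
    simp only [Finset.mem_sigma] at h
    simp [Finset.insert_erase h.2]
  · rintro ⟨T, a⟩ h
    simp only [Finset.mem_sigma, Finset.mem_compl] at h
    simp [Finset.erase_insert h.2]
  · rintro ⟨S, a⟩ h
    simp only [Finset.mem_sigma] at h
    simp [Finset.insert_erase h.2]

/-- Exchanging a point for a different one contributes equally to both compositions. Only the return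
to `T` differs: it occurs `n - |T|` times on the left and `|T|` times on the right. -/
theorem downSum_upSum {α : Type*} [Fintype α] [DecidableEq α] (f : Finset α → ℚ) (T : Finset α) :
    downSum (upSum f) T
      = upSum (downSum f) T + ((Fintype.card α : ℚ) - 2 * T.card) * f T := by
  have h1 : downSum (upSum f) T
      = (Tᶜ.card : ℚ) * f T + ∑ b ∈ T, ∑ a ∈ Tᶜ, f (insert a (T.erase b)) := by
    rw [Finset.sum_comm, downSum, ← nsmul_eq_mul, ← Finset.sum_const, ← Finset.sum_add_distrib]
    refine Finset.sum_congr rfl fun a ha => ?_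
    have ha' : a ∉ T := Finset.mem_compl.1 ha
    rw [upSum, Finset.sum_insert ha', Finset.erase_insert ha']
    congr 1
    refine Finset.sum_congr rfl fun b hb => ?_
    rw [Finset.erase_insert_of_ne]
    rintro rfl
    exact ha' hb
  have h2 : upSum (downSum f) T
      = (T.card : ℚ) * f T + ∑ b ∈ T, ∑ a ∈ Tᶜ, f (insert a (T.erase b)) := by
    rw [upSum, ← nsmul_eq_mul, ← Finset.sum_const, ← Finset.sum_add_distrib]
    refine Finset.sum_congr rfl fun b hb => ?_
    rw [downSum, Finset.compl_erase, Finset.sum_insert (by simpa using hb),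
      Finset.insert_erase hb]
  rw [h1, h2, Finset.card_compl, Nat.cast_sub (Finset.card_le_univ T)]
  ring

/-- A set `x ⊇ T` of size `w` contains exactly `w - |T|` of the sets covering `T`. -/
theorem downSum_coverWeight {α : Type*} [Fintype α] [DecidableEq α] {A : Finset (Finset α)}
    {w : ℕ} (hA : ∀ x ∈ A, x.card = w) (c : Finset α → ℚ) (T : Finset α) :
    downSum (coverWeight A c) T = ((w : ℚ) - T.card) * coverWeight A c T := by
  simp only [downSum, coverWeight]
  rw [Finset.sum_comm, Finset.mul_sum]
  refine Finset.sum_congr rfl fun x hx => ?_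
  split_ifs with h
  · have : ∀ a, (insert a T ⊆ x) ↔ a ∈ x := fun a => by
      rw [Finset.insert_subset_iff]; exact and_iff_left h
    simp only [this]
    rw [← Finset.sum_filter, Finset.sum_const, nsmul_eq_mul, ← hA x hx,
      show Tᶜ.filter (· ∈ x) = x \ T by ext; simp [and_comm], Finset.card_sdiff_of_subset h,
      Nat.cast_sub (Finset.card_le_card h)]
  · rw [mul_zero]
    refine Finset.sum_eq_zero fun a _ => if_neg fun h' => h ?_
    exact (Finset.subset_insert a T).trans h'

theorem coverWeight_eq_zero_of_succ {α : Type*} [Fintype α] [DecidableEq α]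
    {A : Finset (Finset α)} {w : ℕ} (hA : ∀ x ∈ A, x.card = w) (c : Finset α → ℚ) {k : ℕ}
    (hk : k < w) (h : ∀ S, S.card = k + 1 → coverWeight A c S = 0) (T : Finset α)
    (hT : T.card = k) : coverWeight A c T = 0 := by
  have h1 := downSum_coverWeight hA c T
  rw [downSum, Finset.sum_eq_zero fun a ha => h _ (by
    rw [Finset.card_insert_of_notMem (Finset.mem_compl.1 ha), hT])] at h1
  have h2 : (w : ℚ) - T.card ≠ 0 := by
    rw [hT, sub_ne_zero]; exact_mod_cast hk.ne'
  exact (mul_eq_zero.1 h1.symm).resolve_left h2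

theorem sum_mul_choose_card_inter {α : Type*} [DecidableEq α] (A : Finset (Finset α))
    (c : Finset α → ℚ) (x : Finset α) (k : ℕ) :
    ∑ y ∈ A, c y * ((x ∩ y).card.choose k : ℚ)
      = ∑ T ∈ x.powersetCard k, coverWeight A c T := by
  simp only [coverWeight]
  rw [Finset.sum_comm]
  refine Finset.sum_congr rfl fun y _ => ?_
  rw [← Finset.sum_filter, Finset.sum_const, nsmul_eq_mul, mul_comm, ← Finset.card_powersetCard]
  congr 3
  ext T
  simp only [Finset.mem_powersetCard, Finset.mem_filter, Finset.subset_inter_iff]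
  tauto

/-- `C(|x ∩ y|, k)` is the Gram matrix of the incidence vectors with the `k`-sets, so the form is a
sum of squares. -/
theorem sum_sum_mul_choose_card_inter {α : Type*} [Fintype α] [DecidableEq α]
    (A : Finset (Finset α)) (c : Finset α → ℚ) (k : ℕ) :
    ∑ x ∈ A, ∑ y ∈ A, c x * c y * ((x ∩ y).card.choose k : ℚ)
      = ∑ T ∈ Finset.univ.powersetCard k, coverWeight A c T * coverWeight A c T := by
  simp only [mul_assoc, ← Finset.mul_sum, sum_mul_choose_card_inter]
  have h : ∀ T, coverWeight A c T * coverWeight A c T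
      = ∑ x ∈ A, c x * if T ⊆ x then coverWeight A c T else 0 := by
    intro T
    conv_lhs => enter [1]; rw [coverWeight]
    rw [Finset.sum_mul]
    refine Finset.sum_congr rfl fun x _ => ?_
    split_ifs <;> simp
  simp only [h]
  rw [Finset.sum_comm]
  refine Finset.sum_congr rfl fun x _ => ?_
  rw [← Finset.mul_sum, ← Finset.sum_filter]
  congr 2
  ext T
  simp only [Finset.mem_powersetCard, Finset.mem_filter, Finset.subset_univ, true_and]
  tauto

theorem cast_choose_three (m : ℕ) : (m.choose 3 : ℚ) * 6 = m * (m - 1) * (m - 2) := by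
  have := Nat.cast_choose_eq_descPochhammer_div ℚ m 3
  rw [this]
  simp [descPochhammer, Nat.factorial]
  ring

theorem cast_choose_four (m : ℕ) :
    (m.choose 4 : ℚ) * 24 = m * (m - 1) * (m - 2) * (m - 3) := by
  have := Nat.cast_choose_eq_descPochhammer_div ℚ m 4
  rw [this]
  simp [descPochhammer, Nat.factorial]
  ring

theorem cast_choose_two' (m : ℕ) : (m.choose 2 : ℚ) * 2 = m * (m - 1) := by
  rw [Nat.cast_choose_two]; ring

theorem card_inter_cast {α : Type*} [DecidableEq α] {A : Finset (Finset α)} {w : ℕ}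
    (hA : ∀ x ∈ A, x.card = w) {x : Finset α} (hx : x ∈ A) (y : Finset α) :
    ((x ∩ y).card : ℚ) = w - (x \ y).card := by
  have h := Finset.card_inter_add_card_sdiff x y
  rw [hA x hx] at h
  rw [← h]; push_cast; ring

/-! ### Integrality of distances -/

/-- A cubic in `|x \ y| = w - |x ∩ y|` is a combination of `C(|x ∩ y|, k)` with `k ≤ 3`, and
vanishing cover weight on 3-sets passes down to smaller sets. -/
theorem sum_mul_cubic_eq_zero {α : Type*} [Fintype α] [DecidableEq α] {A : Finset (Finset α)}
    {w : ℕ} (hA : ∀ x ∈ A, x.card = w) (hw : 3 ≤ w) {f : Finset α → ℚ}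
    (hf : ∀ S, S.card = 3 → coverWeight A f S = 0) {x : Finset α} (hx : x ∈ A) (a b c : ℚ) :
    ∑ y ∈ A, f y * ((a - (x \ y).card) * (b - (x \ y).card) * (c - (x \ y).card)) = 0 := by
  have h2 := coverWeight_eq_zero_of_succ hA f (k := 2) (by omega) hf
  have h1 := coverWeight_eq_zero_of_succ hA f (k := 1) (by omega) h2
  have h0 := coverWeight_eq_zero_of_succ hA f (k := 0) (by omega) h1
  have hz : ∀ k, (∀ S, S.card = k → coverWeight A f S = 0) →
      ∑ y ∈ A, f y * ((x ∩ y).card.choose k : ℚ) = 0 := fun k hk => by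
    rw [sum_mul_choose_card_inter]
    exact Finset.sum_eq_zero fun T hT => hk T (Finset.mem_powersetCard.1 hT).2
  have e : ∀ y ∈ A,
      f y * ((a - (x \ y).card) * (b - (x \ y).card) * (c - (x \ y).card))
      = 6 * (f y * ((x ∩ y).card.choose 3 : ℚ))
        + (6 - 2 * ((w - a) + (w - b) + (w - c))) * (f y * ((x ∩ y).card.choose 2 : ℚ))
        + (1 - ((w - a) + (w - b) + (w - c)) + ((w - a) * (w - b) + (w - a) * (w - c)
            + (w - b) * (w - c))) * (f y * ((x ∩ y).card.choose 1 : ℚ))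
        - (w - a) * (w - b) * (w - c) * (f y * ((x ∩ y).card.choose 0 : ℚ)) := by
    intro y _
    have e3 := cast_choose_three (x ∩ y).card
    have e2 := cast_choose_two' (x ∩ y).card
    have ht : ((x \ y).card : ℚ) = w - (x ∩ y).card := by
      rw [card_inter_cast hA hx y]; ring
    rw [ht, Nat.choose_one_right, Nat.choose_zero_right, Nat.cast_one]
    linear_combination (-f y) * e3 - f y * (3 - ((w - a) + (w - b) + (w - c))) * e2
  rw [Finset.sum_congr rfl e]
  simp only [Finset.sum_add_distrib, Finset.sum_sub_distrib, ← Finset.mul_sum, hz 3 hf, hz 2 h2,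
    hz 1 h1, hz 0 h0]
  simp

/-- The integrality condition of Larman, Rogers and Seidel for large sets with four distances. -/
theorem dvd_of_choose_three_lt_card {α : Type*} [Fintype α] [DecidableEq α]
    {A : Finset (Finset α)} {w : ℕ} (hA : ∀ x ∈ A, x.card = w) (hw : 3 ≤ w) {a b c d : ℤ}
    (hda : d ≠ a) (hdb : d ≠ b) (hdc : d ≠ c)
    (hD : ∀ x ∈ A, ∀ y ∈ A, x ≠ y →
      ((x \ y).card : ℤ) = a ∨ ((x \ y).card : ℤ) = b ∨ ((x \ y).card : ℤ) = c ∨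
        ((x \ y).card : ℤ) = d)
    (hcard : (Fintype.card α).choose 3 < A.card) :
    (d - a) * (d - b) * (d - c) ∣ a * b * c := by
  obtain ⟨f, ⟨x₀, hx₀, hf₀⟩, -, hf⟩ := exists_ne_zero_sum_eq_zero A
    (Finset.univ.powersetCard 3) (fun T x => if T ⊆ x then 1 else 0)
    (by simpa [Finset.card_powersetCard] using hcard)
  have hf' : ∀ S, S.card = 3 → coverWeight A f S = 0 := fun S hS => by
    have := hf S (Finset.mem_powersetCard.2 ⟨Finset.subset_univ _, hS⟩)
    simpa [coverWeight] using this
  have hda' : (d : ℚ) - a ≠ 0 := sub_ne_zero.2 (by exact_mod_cast hda)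
  have hdb' : (d : ℚ) - b ≠ 0 := sub_ne_zero.2 (by exact_mod_cast hdb)
  have hdc' : (d : ℚ) - c ≠ 0 := sub_ne_zero.2 (by exact_mod_cast hdc)
  -- The cubic with roots `a, b, c` is `abc` on the diagonal and otherwise nonzero only at distance
  -- `d`. As it annihilates `f`, the matrix of distance `d` has `f` as an eigenvector.
  let M : Matrix A A ℤ := Matrix.of fun x y =>
    if (x : Finset α) ≠ y ∧ (((x : Finset α) \ y).card : ℤ) = d then 1 else 0
  have hM : (M.map ((↑) : ℤ → ℚ)).mulVec (fun x : A => f x)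
      = ((a * b * c : ℚ) / ((d - a) * (d - b) * (d - c))) • fun x : A => f x := by
    ext ⟨x, hx⟩
    have h0 := sum_mul_cubic_eq_zero hA hw hf' hx a b c
    have e : ∀ y ∈ A, f y * ((a - (x \ y).card) * (b - (x \ y).card) * (c - (x \ y).card))
        = (if x = y then (a * b * c : ℚ) * f y else 0)
          - (d - a) * (d - b) * (d - c) *
            (if x ≠ y ∧ ((x \ y).card : ℤ) = d then f y else 0) := by
      intro y hy
      by_cases hxy : x = y
      · subst hxy; simp; ring
      · rw [if_neg hxy]
        have hc : (((x \ y).card : ℤ) : ℚ) = ((x \ y).card : ℚ) := by push_cast; rfl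
        rcases hD x hx y hy hxy with h | h | h | h
        · rw [if_neg (by rw [h]; tauto), ← hc, h]; ring
        · rw [if_neg (by rw [h]; tauto), ← hc, h]; ring
        · rw [if_neg (by rw [h]; tauto), ← hc, h]; ring
        · rw [if_pos ⟨hxy, h⟩, ← hc, h]; ring
    rw [Finset.sum_congr rfl e, Finset.sum_sub_distrib, ← Finset.mul_sum, Finset.sum_ite_eq,
      if_pos hx] at h0
    have hL : (M.map ((↑) : ℤ → ℚ)).mulVec (fun x : A => f x) ⟨x, hx⟩
        = ∑ y ∈ A, if x ≠ y ∧ ((x \ y).card : ℤ) = d then f y else 0 := by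
      rw [← Finset.sum_coe_sort A]
      simp only [Matrix.mulVec, dotProduct, M, Matrix.map_apply, Matrix.of_apply]
      refine Finset.sum_congr rfl fun y _ => ?_
      split_ifs <;> simp
    rw [hL, Pi.smul_apply, smul_eq_mul]
    field_simp
    linarith
  obtain ⟨k, hk⟩ := exists_int_of_mulVec_eq_smul M
    (fun h => hf₀ (congrFun h ⟨x₀, hx₀⟩)) hM
  refine ⟨k, ?_⟩
  have : (a * b * c : ℚ) = (d - a) * (d - b) * (d - c) * k := by
    rw [hk]; field_simp
  exact_mod_cast this

/-! ### Dropping the harmonic space of degree three -/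

/-- A bound for sets with four distances whose annihilator polynomial has a nonpositive
coefficient at the third Hahn polynomial. -/
theorem card_add_choose_three_le {α : Type*} [Fintype α] [DecidableEq α]
    {A : Finset (Finset α)} {w n : ℕ} (hn : Fintype.card α = n) (hn6 : 6 < n)
    (hA : ∀ x ∈ A, x.card = w) (hw : 3 ≤ w) {a b c d : ℕ}
    (ha : 0 < a) (hb : 0 < b) (hc : 0 < c) (hd : 0 < d)
    (hD : ∀ x ∈ A, ∀ y ∈ A, x ≠ y →
      (x \ y).card = a ∨ (x \ y).card = b ∨ (x \ y).card = c ∨ (x \ y).card = d)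
    (h : ((n : ℤ) - 6) * (a + b + c + d + 6) + 4 * (w - 3) ^ 2 ≤ 4 * w * (n - 6)) :
    A.card + n.choose 3 ≤ n.choose 2 + n.choose 4 := by
  classical
  by_contra! hlt
  -- The unknowns are `u` on `A` and `g` on 3-sets. The equations make the cover weight `v` of `u`
  -- vanish on 2-sets and equal `upSum g` on 4-sets; among the harmonic components of degree at most
  -- four, this leaves only degree three.
  obtain ⟨f, ⟨i₀, hi₀, hf₀⟩, hfI, hf⟩ := exists_ne_zero_sum_eq_zero
    (A.disjSum (Finset.univ.powersetCard 3))
    ((Finset.univ.powersetCard 2).disjSum (Finset.univ.powersetCard 4 : Finset (Finset α)))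
    (fun k i => match k, i with
      | Sum.inl T, Sum.inl x => if T ⊆ x then 1 else 0
      | Sum.inl _, Sum.inr _ => 0
      | Sum.inr S, Sum.inl x => if S ⊆ x then 1 else 0
      | Sum.inr S, Sum.inr T => - ∑ a ∈ S, if T = S.erase a then 1 else 0)
    (by simpa [Finset.card_disjSum, Finset.card_powersetCard, hn] using hlt)
  set u : Finset α → ℚ := fun x => f (Sum.inl x) with hu
  set g : Finset α → ℚ := fun T => f (Sum.inr T) with hg
  set v := coverWeight A u with hv
  have hnQ : (0 : ℚ) < n - 6 := by rw [sub_pos]; exact_mod_cast hn6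
  have hwQ : (0 : ℚ) ≤ w - 3 := by rw [sub_nonneg]; exact_mod_cast hw
  have v2 : ∀ T, T.card = 2 → v T = 0 := fun T hT => by
    have := hf (Sum.inl T) (by simp [hT])
    simpa [Finset.sum_disjSum, hv, coverWeight] using this
  have v1 := coverWeight_eq_zero_of_succ hA u (k := 1) (by omega) v2
  have v0 := coverWeight_eq_zero_of_succ hA u (k := 0) (by omega) v1
  have v4 : ∀ S, S.card = 4 → v S = upSum g S := fun S hS => by
    have := hf (Sum.inr S) (by simp [hS])
    simp only [Finset.sum_disjSum, mul_ite, mul_one, mul_zero, mul_neg, Finset.sum_neg_distrib,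
      Finset.mul_sum] at this
    rw [Finset.sum_comm (s := Finset.univ.powersetCard 3)] at this
    have e : ∀ a ∈ S, ∑ T ∈ Finset.univ.powersetCard 3,
        (if T = S.erase a then f (Sum.inr T) else 0) = g (S.erase a) := fun a ha => by
      rw [Finset.sum_ite_eq', if_pos]
      simp [Finset.card_erase_of_mem ha, hS]
    rw [Finset.sum_congr rfl e] at this
    exact add_neg_eq_zero.1 this
  have v3 : ∀ T, T.card = 3 →
      ((w : ℚ) - 3) * v T = upSum (downSum g) T + ((n : ℚ) - 6) * g T := fun T hT => by
    have e1 := downSum_coverWeight hA u T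
    have e2 : downSum (coverWeight A u) T = downSum (upSum g) T :=
      Finset.sum_congr rfl fun a ha => v4 _ (by
        rw [Finset.card_insert_of_notMem (Finset.mem_compl.1 ha), hT])
    rw [e2, downSum_upSum, hn, hT] at e1
    push_cast at e1
    linarith
  set P3 : Finset (Finset α) := Finset.univ.powersetCard 3 with hP3
  set P2 : Finset (Finset α) := Finset.univ.powersetCard 2 with hP2
  have mem3 : ∀ T ∈ P3, T.card = 3 := fun T hT => (Finset.mem_powersetCard.1 hT).2
  have mem2 : ∀ T ∈ P2, T.card = 2 := fun T hT => (Finset.mem_powersetCard.1 hT).2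
  -- Pair `v3` with `v`: the term `upSum (downSum g)` drops out by adjointness, because `downSum v`
  -- is a multiple of `v` on 2-sets and so zero.
  have hgv : ((w : ℚ) - 3) * ∑ T ∈ P3, v T * v T = (n - 6) * ∑ T ∈ P3, v T * g T := by
    have e := sum_mul_upSum (downSum g) v 2
    have z : ∑ T ∈ P2, downSum v T * downSum g T = 0 := Finset.sum_eq_zero fun T hT => by
      rw [hv, downSum_coverWeight hA, ← hv, v2 T (mem2 T hT)]; simp
    rw [z] at e
    have : ∑ T ∈ P3, (v T * (upSum (downSum g) T + ((n : ℚ) - 6) * g T))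
        = ∑ T ∈ P3, v T * (((w : ℚ) - 3) * v T) :=
      Finset.sum_congr rfl fun T hT => by rw [v3 T (mem3 T hT)]
    simp only [mul_add, Finset.sum_add_distrib] at this
    rw [e] at this
    rw [Finset.mul_sum, Finset.mul_sum]
    calc _ = ∑ T ∈ P3, v T * (((w : ℚ) - 3) * v T) :=
          Finset.sum_congr rfl fun T _ => by ring
      _ = _ := by
          rw [← this, zero_add]
          exact Finset.sum_congr rfl fun T _ => by ring
  have hW4 : ∑ S ∈ Finset.univ.powersetCard 4, v S * v S
      = ((w : ℚ) - 3) * ∑ T ∈ P3, v T * g T := by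
    have e := sum_mul_upSum g v 3
    rw [Finset.mul_sum]
    calc _ = ∑ S ∈ Finset.univ.powersetCard 4, v S * upSum g S :=
          Finset.sum_congr rfl fun S hS => by
            rw [← v4 S (Finset.mem_powersetCard.1 hS).2]
      _ = _ := by
          rw [e]
          refine Finset.sum_congr rfl fun T hT => ?_
          rw [hv, downSum_coverWeight hA, mem3 T hT]
          push_cast; ring
  -- If `u` vanished on `A`, then `v = 0`, and pairing `v3` with `g` would give `|downSum g|² + (n -
  -- 6) |g|² = 0`, so `g` would vanish too.
  have hune : ∃ x ∈ A, u x ≠ 0 := by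
    by_contra! hall
    have hv0 : ∀ T, v T = 0 := fun T => by
      rw [hv, coverWeight]
      exact Finset.sum_eq_zero fun x hx => by rw [hall x hx]; simp
    have hg0 : ∑ T ∈ P3, g T * upSum (downSum g) T + (n - 6) * ∑ T ∈ P3, g T * g T = 0 := by
      rw [Finset.mul_sum, ← Finset.sum_add_distrib]
      refine Finset.sum_eq_zero fun T hT => ?_
      have := v3 T (mem3 T hT)
      rw [hv0, mul_zero] at this
      linear_combination (-g T) * this
    have e := sum_mul_upSum (downSum g) g 2
    rw [e] at hg0
    have p1 : 0 ≤ ∑ T ∈ P2, downSum g T * downSum g T :=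
      Finset.sum_nonneg fun T _ => mul_self_nonneg _
    have p2 : 0 ≤ ∑ T ∈ P3, g T * g T := Finset.sum_nonneg fun T _ => mul_self_nonneg _
    have p3 : ∑ T ∈ P3, g T * g T = 0 := by nlinarith
    rw [Finset.sum_eq_zero_iff_of_nonneg fun T _ => mul_self_nonneg _] at p3
    rcases i₀ with x | T
    · exact hf₀ (hall x (by simpa using hi₀))
    · exact hf₀ (mul_self_eq_zero.1 (p3 T (by simpa using hi₀)))
  -- The annihilator is `abcd` on the diagonal and zero elsewhere. Expanded in `C(m, k)` with `m =
  -- |x ∩ y|`, only `k = 3, 4` survive; the coefficients come from `m⁴ = 24 C(m, 4) + 36 C(m, 3) +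
  -- ...` and `m³ = 6 C(m, 3) + ...`.
  have hform : (a * b * c * d : ℚ) * ∑ x ∈ A, u x * u x
      = 24 * ∑ S ∈ Finset.univ.powersetCard 4, v S * v S
        + (36 - 6 * (4 * w - (a + b + c + d))) * ∑ T ∈ P3, v T * v T := by
    have hz : ∀ k, (∀ S, S.card = k → v S = 0) →
        ∑ x ∈ A, ∑ y ∈ A, u x * u y * ((x ∩ y).card.choose k : ℚ) = 0 := fun k hk => by
      rw [sum_sum_mul_choose_card_inter]
      exact Finset.sum_eq_zero fun T hT => by
        rw [← hv, hk T (Finset.mem_powersetCard.1 hT).2, mul_zero]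
    have e : ∀ x ∈ A, ∀ y ∈ A, (if x = y then (a * b * c * d : ℚ) * (u x * u y) else 0)
        = 24 * (u x * u y * ((x ∩ y).card.choose 4 : ℚ))
          + (36 - 6 * (4 * w - (a + b + c + d))) * (u x * u y * ((x ∩ y).card.choose 3 : ℚ))
          + (14 - 6 * (4 * w - (a + b + c + d)) + 2 * ((w - a) * (w - b) + (w - a) * (w - c)
              + (w - a) * (w - d) + (w - b) * (w - c) + (w - b) * (w - d) + (w - c) * (w - d)))
            * (u x * u y * ((x ∩ y).card.choose 2 : ℚ))
          + (1 - (4 * w - (a + b + c + d)) + ((w - a) * (w - b) + (w - a) * (w - c)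
              + (w - a) * (w - d) + (w - b) * (w - c) + (w - b) * (w - d) + (w - c) * (w - d))
              - ((w - a) * (w - b) * (w - c) + (w - a) * (w - b) * (w - d)
                + (w - a) * (w - c) * (w - d) + (w - b) * (w - c) * (w - d)))
            * (u x * u y * ((x ∩ y).card.choose 1 : ℚ))
          + (w - a) * (w - b) * (w - c) * (w - d)
            * (u x * u y * ((x ∩ y).card.choose 0 : ℚ)) := by
      intro x hx y hy
      have e4 := cast_choose_four (x ∩ y).card
      have e3 := cast_choose_three (x ∩ y).card
      have e2 := cast_choose_two' (x ∩ y).card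
      have hp : (if x = y then (a * b * c * d : ℚ) * (u x * u y) else 0)
          = u x * u y * ((a - (x \ y).card) * (b - (x \ y).card) * (c - (x \ y).card)
            * (d - (x \ y).card)) := by
        by_cases hxy : x = y
        · subst hxy; simp; ring
        · rw [if_neg hxy]
          rcases hD x hx y hy hxy with h | h | h | h <;> rw [h] <;> ring
      have ht : ((x \ y).card : ℚ) = w - (x ∩ y).card := by
        rw [card_inter_cast hA hx y]; ring
      rw [hp, ht, Nat.choose_one_right, Nat.choose_zero_right, Nat.cast_one]
      linear_combination (-(u x * u y)) * e4
        - u x * u y * (6 - (4 * w - (a + b + c + d))) * e3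
        - u x * u y * (7 - 3 * (4 * w - (a + b + c + d)) + ((w - a) * (w - b) + (w - a) * (w - c)
              + (w - a) * (w - d) + (w - b) * (w - c) + (w - b) * (w - d) + (w - c) * (w - d)))
            * e2
    have hsum := Finset.sum_congr rfl fun x hx => Finset.sum_congr rfl fun y hy => e x hx y hy
    simp only [Finset.sum_add_distrib, ← Finset.mul_sum, hz 2 v2, hz 1 v1, hz 0 v0,
      mul_zero, add_zero] at hsum
    rw [sum_sum_mul_choose_card_inter, sum_sum_mul_choose_card_inter, ← hv] at hsum
    rw [← hsum, Finset.mul_sum]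
    refine Finset.sum_congr rfl fun x hx => ?_
    rw [Finset.sum_ite_eq, if_pos hx]
  have hpos : 0 < (a * b * c * d : ℚ) * ∑ x ∈ A, u x * u x := by
    obtain ⟨x, hx, hux⟩ := hune
    refine mul_pos (by positivity) (Finset.sum_pos' (fun y _ => mul_self_nonneg _)
      ⟨x, hx, mul_self_pos.2 hux⟩)
  have hW3 : 0 ≤ ∑ T ∈ P3, v T * v T := Finset.sum_nonneg fun T _ => mul_self_nonneg _
  have hQ : ((n : ℚ) - 6) * (a + b + c + d + 6) + 4 * (w - 3) ^ 2 ≤ 4 * w * (n - 6) := by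
    exact_mod_cast h
  rw [hform, hW4] at hpos
  have h1 : 0 < ((n : ℚ) - 6) * (24 * (((w : ℚ) - 3) * ∑ T ∈ P3, v T * g T)
      + (36 - 6 * (4 * w - (a + b + c + d))) * ∑ T ∈ P3, v T * v T) := mul_pos hnQ hpos
  have h2 : ((n : ℚ) - 6) * (24 * (((w : ℚ) - 3) * ∑ T ∈ P3, v T * g T)
      + (36 - 6 * (4 * w - (a + b + c + d))) * ∑ T ∈ P3, v T * v T)
      = 6 * ((((n : ℚ) - 6) * (a + b + c + d + 6) + 4 * (w - 3) ^ 2) - 4 * w * (n - 6))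
        * ∑ T ∈ P3, v T * v T := by
    linear_combination (-24 * ((w : ℚ) - 3)) * hgv
  rw [h2] at h1
  nlinarith

/-! ### Linear programming certificates -/

/-- A certificate for the linear programming bound: all sets in the Johnson space with parameters
`n`, `w` whose distances `t` are marked by the binary digits of `dists` have at most `bound`
elements. The `weights` refer to the normalized Hahn polynomials. -/
structure LPCertificate where
  n : ℕ
  w : ℕ
  dists : ℕ
  bound : ℕ
  weights : List (ℕ × ℕ)

/-- The weights of a certificate with respect to the unnormalized Hahn polynomials, up to a common
factor. -/
def LPCertificate.coeffs (C : LPCertificate) : List (ℕ × ℕ) :=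
  -- `J` is the largest degree. Since `Q_j(0) = (w)_j (n - w)_j`, multiplying the normalized weights
  -- by `(w)_J (n - w)_J / Q_j(0)` clears all denominators.
  let J := (C.weights.map Prod.fst).foldr max 0
  C.weights.map fun jy => (jy.1, jy.2 * ((C.w - jy.1).descFactorial (J - jy.1) *
    (C.n - C.w - jy.1).descFactorial (J - jy.1)))

/-- The check that the values of a polynomial `F` satisfy `b * F t + F 0 < 0` for all marked `t`. -/
def lpCheck (n w dists b : ℕ) (l : List (ℕ × ℕ)) : Bool :=
  (List.range (w + 1)).all fun t => !dists.testBit t ||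
    decide ((b : ℤ) * hahnSum n w t l + hahnSum n w 0 l < 0)

def LPCertificate.isValid (C : LPCertificate) : Bool :=
  Nat.ble 1 C.bound && lpCheck C.n C.w C.dists C.bound C.coeffs

/-- Certificates that cover all quadruples of distances which satisfy the integrality conditions. -/
def johnsonCertificates : List LPCertificate := [
  ⟨62, 29, 1073737728, 73853, [(1, 1757), (2, 15580), (3, 123081), (4, 351241), (5, 1000000), (6, 859108)]⟩,
  ⟨58, 28, 536868864, 91430, [(1, 107), (2, 1192), (3, 7649), (4, 28466), (5, 69207), (6, 99999), (7, 62674)]⟩,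
  ⟨54, 26, 134216704, 101311, [(1, 8), (2, 78), (3, 493), (4, 1931), (5, 5239), (6, 8934), (7, 9999)]⟩,
  ⟨61, 28, 536727040, 178412, [(1, 147), (2, 163), (3, 1129), (5, 71526), (6, 365473), (7, 1000000)]⟩,
  ⟨56, 21, 4193280, 52395, [(1, 18), (2, 135), (3, 1019), (4, 3020), (5, 8134), (6, 9999)]⟩,
  ⟨59, 23, 16762624, 73853, [(1, 32), (5, 12472), (6, 41591), (7, 99999), (8, 49440)]⟩,
  ⟨58, 29, 1073727232, 178412, [(1, 363), (5, 46982), (6, 348983), (7, 949872), (8, 1000000), (9, 351783)]⟩,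
  ⟨63, 29, 1073339392, 230350, [(1, 1), (3, 1058), (4, 2331), (5, 11689), (6, 61935), (7, 99999)]⟩,
  ⟨63, 24, 33552384, 249951, [(1, 275), (2, 3006), (3, 23121), (4, 95873), (5, 341738), (6, 575061), (7, 1000000)]⟩,
  ⟨53, 21, 4191104, 73853, [(1, 49), (2, 1), (5, 14575), (6, 59103), (7, 99999)]⟩,
  ⟨65, 24, 33410560, 249951, [(1, 16), (2, 30), (3, 123), (5, 7933), (6, 50768), (7, 99999)]⟩,
  ⟨61, 28, 536805424, 178412, [(1, 16), (13, 4230), (14, 1524), (15, 99999)]⟩,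
  ⟨57, 24, 33538240, 149040, [(1, 33), (2, 47), (8, 10057), (9, 79440), (10, 99999)]⟩,
  ⟨58, 23, 16776192, 230350, [(1, 313), (2, 3322), (3, 25156), (4, 101061), (5, 354465), (6, 577404), (7, 1000000)]⟩,
  ⟨52, 25, 67105664, 135795, [(1, 297), (2, 397), (5, 85626), (6, 360703), (7, 1000000), (8, 561640)]⟩,
  ⟨59, 28, 536817920, 230350, [(1, 736), (2, 1227), (3, 16821), (4, 33655), (5, 82178), (7, 1111636), (8, 6890965), (9, 10000000)]⟩,
  ⟨45, 18, 524032, 20503, [(1, 366), (2, 2987), (3, 16605), (4, 47725), (5, 99999), (6, 93329)]⟩,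
  ⟨70, 29, 1072929792, 230350, [(1, 35), (2, 118), (3, 2717), (5, 9689), (6, 235147), (7, 1000000), (8, 633104)]⟩,
  ⟨62, 24, 4179712, 230350, [(1, 102), (2, 158), (5, 3446), (6, 207326), (7, 240972), (8, 1000000)]⟩,
  ⟨58, 29, 1073640192, 123453, [(1, 4), (3, 746), (4, 282), (7, 99533), (8, 99999)]⟩,
  ⟨58, 27, 259506240, 211925, [(1, 8), (2, 36), (3, 61), (10, 27479), (11, 99999)]⟩,
  ⟨59, 27, 32742912, 135795, [(5, 137), (6, 45), (7, 48), (8, 999)]⟩,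
  ⟨51, 23, 16773128, 123453, [(1, 166), (2, 747), (3, 1839), (15, 1000000), (16, 305575)]⟩,
  ⟨63, 22, 523264, 230350, [(2, 4208), (3, 4093), (4, 148010), (5, 126207), (6, 1000000), (7, 550998)]⟩,
  ⟨50, 24, 33541312, 82290, [(1, 138), (3, 2572), (4, 8448), (5, 10993), (7, 277006), (8, 1000000), (9, 965297)]⟩,
  ⟨54, 24, 32978688, 73853, [(3, 676), (4, 3013), (5, 11177), (6, 35760), (7, 99999)]⟩,
  ⟨59, 19, 1042176, 66082, [(1, 8), (4, 1079), (5, 5918), (6, 9999), (7, 3154)]⟩,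
  ⟨50, 21, 4190240, 82290, [(1, 3), (2, 9), (3, 20), (9, 5848), (10, 9999)]⟩,
  ⟨49, 22, 3665928, 46410, [(1, 569), (2, 1259), (3, 150), (14, 1000000)]⟩,
  ⟨50, 23, 16751808, 111972, [(2, 28), (3, 711), (7, 78204), (8, 81175), (9, 99999)]⟩,
  ⟨64, 28, 536635136, 316305, [(1, 173), (3, 4846), (4, 11711), (7, 1921015), (8, 5034390), (9, 10000000)]⟩,
  ⟨63, 29, 536805424, 395067, [(1, 115), (2, 140), (15, 569651), (16, 1000000)]⟩,
  ⟨60, 18, 521088, 178412, [(1, 2), (2, 1), (5, 1563), (6, 4340), (7, 9999)]⟩,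
  ⟨44, 22, 8387008, 27435, [(1, 58), (4, 3840), (5, 31526), (6, 66127), (7, 99999)]⟩,
  ⟨47, 22, 8248512, 91430, [(1, 25), (2, 158), (3, 534), (6, 18229), (7, 99999), (8, 28000)]⟩,
  ⟨43, 20, 2072448, 27435, [(2, 72), (3, 956), (5, 9999), (6, 3447)]⟩,
  ⟨58, 20, 1941248, 111972, [(3, 5555), (4, 13392), (5, 143938), (6, 67465), (7, 1000000)]⟩,
  ⟨60, 22, 1700224, 211925, [(1, 2), (2, 84), (3, 24), (6, 3128), (8, 99999), (9, 459)]⟩,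
  ⟨47, 21, 3667984, 73853, [(1, 204), (2, 776), (3, 1890), (10, 149949), (11, 1000000)]⟩,
  ⟨61, 23, 8372416, 270777, [(1, 7), (2, 23), (3, 44), (8, 867), (9, 18609), (10, 99999)]⟩,
  ⟨58, 29, 1073643008, 270777, [(3, 694), (4, 2210), (5, 11965), (6, 24115), (7, 99999), (8, 71830)]⟩,
  ⟨43, 19, 1046112, 46410, [(1, 7), (2, 6), (3, 55), (6, 294), (7, 7277), (8, 9999)]⟩,
  ⟨50, 20, 2093068, 135795, [(1, 2), (2, 2), (15, 3000), (16, 1591)]⟩,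
  ⟨61, 26, 121574144, 270777, [(1, 363), (3, 363), (4, 25982), (6, 30016), (7, 540212), (8, 4518912), (9, 10000000)]⟩,
  ⟨57, 21, 3654720, 135795, [(1, 6164), (4, 307658), (5, 602163), (9, 100000000), (10, 5125617)]⟩,
  ⟨53, 23, 1996544, 66082, [(3, 70), (5, 778), (6, 3000)]⟩,
  ⟨41, 20, 2094688, 23780, [(1, 3), (3, 23), (6, 418), (7, 3000), (8, 1005)]⟩,
  ⟨46, 22, 8385120, 101311, [(1, 152), (3, 619), (4, 2455), (5, 18210), (7, 57938), (8, 287653), (9, 1000000)]⟩,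
  ⟨54, 26, 499200, 91430, [(1, 1), (3, 210), (4, 42141), (6, 99999)]⟩,
  ⟨57, 28, 536621120, 249951, [(3, 1883), (10, 443115), (11, 1000000)]⟩,
  ⟨38, 18, 515520, 23780, [(1, 1384), (2, 10634), (3, 79232), (4, 316327), (5, 1000000)]⟩,
  ⟨57, 22, 8369024, 249951, [(1, 166), (2, 47), (3, 430), (5, 19969), (6, 152001), (7, 740264), (8, 1000000)]⟩,
  ⟨56, 19, 1044488, 163231, [(1, 15), (2, 70), (3, 117), (14, 99999)]⟩,
  ⟨58, 21, 4059904, 270777, [(1, 1144), (2, 5558), (3, 13748), (5, 551133), (6, 2380348), (7, 7204079), (8, 10000000)]⟩,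
  ⟨62, 17, 63232, 135795, [(2, 31), (3, 74), (4, 1428), (5, 3157), (6, 9999)]⟩,
  ⟨58, 22, 8337152, 249951, [(1, 1), (3, 435), (4, 2287), (5, 10560), (6, 36461), (7, 99999), (8, 94913)]⟩,
  ⟨41, 19, 1042368, 27435, [(3, 46), (4, 109), (5, 326), (6, 971), (7, 999)]⟩,
  ⟨52, 22, 8363200, 178412, [(3, 42), (4, 11), (7, 3961), (8, 9999), (9, 7076)]⟩,
  ⟨58, 27, 268202048, 316305, [(2, 9), (3, 1726), (10, 429241), (11, 1000000)]⟩,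
  ⟨51, 17, 260544, 73853, [(1, 327), (5, 200356), (6, 473128), (7, 1000000), (8, 91984)]⟩,
  ⟨37, 15, 8128, 17577, [(1, 1), (2, 57), (3, 6), (4, 1012), (6, 3000)]⟩,
  ⟨47, 20, 2093664, 101311, [(1, 14), (4, 365), (5, 1894), (7, 5705), (8, 30940), (9, 99999), (10, 6218)]⟩,
  ⟨50, 19, 842944, 58941, [(1, 6), (2, 217), (3, 190), (6, 9808), (7, 99999)]⟩,
  ⟨61, 27, 254914944, 249951, [(2, 24), (3, 93), (9, 99999)]⟩,
  ⟨34, 16, 130864, 7337, [(1, 11), (2, 13), (3, 2), (5, 482), (6, 2012), (7, 3000)]⟩,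
  ⟨43, 19, 1038640, 40953, [(1, 144), (3, 347), (5, 24790), (8, 36122), (9, 1000000), (10, 396238)]⟩,
  ⟨62, 28, 31931904, 292878, [(5, 11), (6, 4), (7, 7), (8, 200)]⟩,
  ⟨58, 26, 133967936, 292878, [(3, 4), (10, 330), (11, 3000)]⟩,
  ⟨58, 28, 536637504, 395067, [(3, 4), (10, 724), (11, 3000)]⟩,
  ⟨59, 13, 8064, 46376, [(2, 10), (3, 31), (4, 267), (5, 449), (6, 999)]⟩,
  ⟨43, 14, 8128, 40920, [(2, 1121), (3, 2283), (4, 26712), (5, 26651), (6, 99999)]⟩,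
  ⟨58, 29, 1072930560, 341110, [(1, 15), (5, 53788), (6, 43758), (7, 95448), (8, 832067), (9, 1000000)]⟩,
  ⟨40, 20, 2096352, 82290, [(1, 1), (4, 109), (5, 685), (6, 1904), (7, 3000), (8, 2618), (9, 967)]⟩,
  ⟨57, 23, 1897216, 211925, [(2, 25), (3, 39), (6, 14916), (7, 145), (8, 99999)]⟩,
  ⟨49, 17, 259680, 101311, [(1, 256), (2, 282), (3, 3883), (5, 5564), (7, 270376), (8, 1000000)]⟩,
  ⟨48, 22, 2068000, 91430, [(3, 347), (9, 10329), (10, 99999)]⟩,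
  ⟨64, 20, 1900032, 292878, [(2, 288), (3, 9045), (5, 221083), (6, 51501), (7, 1000000), (8, 172303)]⟩,
  ⟨32, 14, 32608, 8878, [(1, 6), (2, 27), (3, 133), (4, 408), (5, 999), (6, 912)]⟩,
  ⟨59, 29, 1068626048, 341110, [(1, 1), (2, 45), (3, 152), (8, 13379), (9, 99999), (10, 42276)]⟩,
  ⟨58, 29, 1073508416, 395067, [(3, 15), (10, 2680), (11, 9999)]⟩,
  ⟨58, 16, 130816, 270777, [(1, 344), (2, 4010), (3, 33247), (4, 143453), (5, 480599), (6, 817820), (7, 1000000)]⟩,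
  ⟨45, 17, 249280, 27405, [(3, 2456), (4, 1429), (5, 46804), (6, 99999)]⟩,
  ⟨57, 17, 236928, 123453, [(3, 8), (4, 5), (5, 28), (6, 338), (7, 400)]⟩,
  ⟨58, 16, 97472, 123453, [(1, 175), (2, 2163), (5, 18997), (6, 180715), (7, 1000000), (8, 5667)]⟩,
  ⟨29, 12, 8160, 3895, [(1, 16), (2, 105), (3, 429), (4, 723), (5, 999)]⟩,
  ⟨41, 13, 16176, 20475, [(1, 14), (2, 27), (5, 551), (6, 4723), (7, 9999), (8, 447)]⟩,
  ⟨57, 20, 325824, 211925, [(2, 1), (8, 999), (9, 24)]⟩,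
  ⟨58, 13, 16256, 123453, [(1, 878), (2, 12828), (3, 95482), (4, 404268), (5, 952778), (6, 1000000)]⟩,
  ⟨41, 12, 7984, 12650, [(1, 8), (5, 404), (6, 3000), (7, 375)]⟩,
  ⟨70, 11, 3936, 82251, [(1, 27), (2, 141), (3, 27), (5, 21046), (6, 99999)]⟩,
  ⟨35, 16, 128736, 14976, [(1, 5), (3, 967), (4, 1694), (5, 9999), (6, 7459)]⟩,
  ⟨59, 25, 66875456, 367346, [(3, 18), (10, 5269), (11, 9999)]⟩,
  ⟨60, 10, 1904, 91390, [(1, 177), (2, 291), (4, 26586), (5, 168595), (6, 320937), (7, 1000000)]⟩,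
  ⟨72, 12, 6080, 148995, [(3, 116), (4, 209), (5, 2598), (6, 4894), (7, 9999)]⟩,
  ⟨38, 11, 2016, 12650, [(2, 21), (3, 28), (4, 340), (5, 310), (6, 999)]⟩,
  ⟨39, 15, 63236, 23780, [(1, 45), (2, 252), (3, 858), (12, 99999)]⟩,
  ⟨70, 11, 1968, 178365, [(2, 3), (3, 4), (4, 20), (6, 631), (7, 3000)]⟩,
  ⟨40, 10, 1904, 14950, [(1, 47), (3, 1120), (4, 9305), (5, 23552), (6, 36980), (7, 99999)]⟩,
  ⟨70, 10, 1496, 111930, [(2, 22), (3, 566), (7, 99999), (8, 44518)]⟩,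
  ⟨41, 20, 62304, 31496, [(1, 36), (3, 1502), (4, 28557), (6, 199424), (7, 182352), (8, 1000000), (9, 196873)]⟩,
  ⟨59, 13, 7616, 82290, [(2, 2), (4, 580), (5, 1982), (6, 3110), (8, 9999)]⟩,
  ⟨52, 10, 1968, 27405, [(1, 2), (2, 8), (4, 12), (5, 792), (6, 3000)]⟩,
  ⟨52, 10, 992, 35960, [(2, 4), (3, 17), (4, 107), (5, 266), (6, 400)]⟩,
  ⟨71, 10, 1968, 635376, [(1, 2), (2, 18), (3, 48), (5, 1210), (6, 9999), (7, 4063)]⟩,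
  ⟨72, 11, 3040, 249900, [(3, 19), (4, 64), (5, 551), (6, 1588), (7, 3000)]⟩,
  ⟨49, 16, 54112, 58941, [(4, 1), (6, 11), (8, 99), (9, 8)]⟩,
  ⟨69, 11, 376, 230300, [(6, 6658), (7, 3926), (8, 69137), (9, 99999)]⟩,
  ⟨72, 10, 1504, 46376, [(3, 3), (4, 9), (5, 60), (6, 99)]⟩,
  ⟨50, 18, 251952, 111972, [(1, 137), (2, 441), (3, 1232), (9, 173442), (10, 1000000)]⟩,
  ⟨55, 10, 376, 46376, [(5, 37), (6, 24), (7, 324), (8, 400)]⟩,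
  ⟨62, 28, 523345408, 367346, [(5, 51), (6, 263), (7, 240), (9, 3000)]⟩,
  ⟨39, 15, 32144, 35992, [(1, 57), (2, 6), (3, 658), (4, 1031), (8, 99999)]⟩,
  ⟨55, 25, 1897344, 270777, [(2, 2), (3, 4), (6, 1596), (8, 9999), (9, 1069)]⟩,
  ⟨24, 11, 4080, 2380, [(1, 56), (2, 256), (3, 1097), (4, 1454), (5, 3000), (10, 2581)]⟩,
  ⟨70, 11, 3440, 292825, [(1, 8), (4, 61), (6, 20716), (8, 99999)]⟩,
  ⟨54, 16, 112320, 123453, [(1, 4), (2, 314), (3, 4973), (5, 133669), (6, 58850), (7, 909799), (8, 1000000)]⟩,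
  ⟨54, 25, 60594368, 178412, [(2, 3), (3, 13), (8, 5508), (9, 9999)]⟩,
  ⟨38, 12, 6064, 23751, [(2, 8), (3, 3), (5, 517), (6, 559), (7, 3000)]⟩,
  ⟨51, 20, 2068000, 149040, [(3, 275), (4, 57), (7, 2889), (9, 32590), (10, 99999)]⟩,
  ⟨41, 15, 14048, 31496, [(4, 9), (5, 10), (6, 99)]⟩,
  ⟨71, 11, 752, 91390, [(5, 18), (6, 10), (7, 194), (8, 200)]⟩,
  ⟨39, 10, 1400, 12650, [(4, 5), (5, 32), (7, 200), (8, 31)]⟩,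
  ⟨27, 13, 16344, 8878, [(1, 21), (2, 39), (3, 43), (5, 1244), (6, 2774), (7, 4144), (11, 9999), (12, 2086)]⟩,
  ⟨58, 16, 129072, 194628, [(1, 115), (2, 497), (3, 876), (9, 395434), (10, 1000000)]⟩,
  ⟨58, 15, 56160, 178412, [(2, 2), (5, 288), (6, 152), (8, 9999)]⟩,
  ⟨39, 15, 55776, 12675, [(3, 6), (4, 51), (5, 145), (7, 999)]⟩,
  ⟨43, 16, 129840, 91430, [(1, 3), (3, 19), (7, 3691), (8, 9999), (9, 2144)]⟩,
  ⟨32, 16, 4064, 12675, [(2, 73), (4, 1066), (6, 3000), (16, 2258)]⟩,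
  ⟨49, 24, 2072096, 163231, [(1, 2), (3, 257), (4, 132), (7, 229), (10, 99999), (11, 15100)]⟩,
  ⟨55, 9, 372, 40920, [(4, 21), (6, 68), (8, 999)]⟩,
  ⟨30, 14, 32696, 17577, [(1, 77), (5, 7495), (6, 15316), (7, 17355), (9, 7852), (10, 27967), (14, 99999)]⟩,
  ⟨45, 10, 1776, 17550, [(3, 2525), (4, 10595), (5, 25003), (6, 99999), (7, 60235)]⟩,
  ⟨70, 10, 372, 249900, [(2, 25), (5, 16013), (7, 67578), (9, 1000000)]⟩,
  ⟨58, 17, 253964, 31496, [(1, 2), (14, 3000), (15, 779)]⟩,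
  ⟨58, 17, 251936, 211925, [(1, 76), (2, 357), (3, 1610), (9, 221768), (10, 1000000)]⟩,
  ⟨68, 10, 936, 148995, [(2, 71), (4, 1), (5, 553), (6, 11523), (8, 99999)]⟩,
  ⟨38, 9, 376, 8855, [(4, 17), (6, 99), (7, 48)]⟩,
  ⟨40, 10, 1964, 20475, [(1, 477), (2, 1298), (4, 520), (5, 23880), (6, 11714), (8, 1000000)]⟩,
  ⟨33, 13, 14040, 8855, [(1, 12), (2, 213), (3, 164), (4, 1629), (5, 1740), (7, 53043), (8, 99999)]⟩,
  ⟨35, 10, 2008, 17550, [(1, 11), (2, 36), (3, 17), (5, 1305), (6, 6255), (7, 9999)]⟩,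
  ⟨58, 15, 63536, 178412, [(1, 27), (2, 72), (8, 4811), (9, 99999)]⟩,
  ⟨60, 18, 497696, 230350, [(1, 3), (2, 2), (3, 198), (10, 99999)]⟩,
  ⟨73, 11, 1496, 395010, [(3, 5), (4, 61), (8, 9999), (9, 1809)]⟩,
  ⟨72, 10, 1400, 595665, [(1, 16), (5, 24888), (6, 63181), (7, 435824), (8, 1000000)]⟩,
  ⟨34, 14, 23416, 17577, [(5, 40), (6, 477), (9, 3000), (13, 245)]⟩,
  ⟨43, 9, 472, 10626, [(1, 1), (2, 7), (4, 3), (5, 214), (6, 999)]⟩,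
  ⟨71, 11, 1880, 292825, [(2, 4), (4, 20), (5, 10), (6, 134), (8, 9999)]⟩,
  ⟨30, 9, 496, 3876, [(2, 6), (3, 7), (4, 62), (5, 52), (6, 99)]⟩,
  ⟨27, 9, 888, 2380, [(3, 15), (4, 10), (5, 55), (6, 99)]⟩,
  ⟨59, 19, 902720, 292878, [(1, 53), (4, 2481), (5, 13853), (8, 67804), (9, 921016), (10, 1000000)]⟩,
  ⟨60, 16, 122240, 341110, [(1, 57), (2, 115), (3, 19666), (5, 66790), (6, 1000000), (7, 106314)]⟩,
  ⟨29, 14, 30448, 8878, [(3, 368), (4, 878), (5, 1835), (6, 2896), (7, 9999), (14, 8980)]⟩,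
  ⟨56, 10, 372, 111930, [(4, 1), (5, 70), (7, 262), (9, 3000)]⟩,
  ⟨44, 22, 8387456, 123453, [(1, 62), (2, 619), (3, 4444), (4, 20142), (5, 59425), (6, 99999), (7, 94545)]⟩,
  ⟨31, 11, 3568, 10650, [(2, 4), (3, 41), (4, 3), (5, 280), (8, 6), (10, 999)]⟩,
  ⟨47, 10, 472, 27405, [(2, 10), (3, 9), (6, 774), (7, 3000)]⟩,
  ⟨59, 19, 842176, 341110, [(2, 1), (7, 1180), (8, 3000), (9, 362), (10, 1158)]⟩,
  ⟨26, 11, 4010, 3895, [(1, 146), (3, 762), (4, 1727), (5, 4044), (8, 24474), (11, 99999)]⟩,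
  ⟨41, 9, 936, 10626, [(1, 1), (2, 1), (4, 25), (5, 77), (7, 999)]⟩,
  ⟨36, 8, 372, 5985, [(2, 3), (3, 33), (5, 52), (7, 999)]⟩,
  ⟨46, 12, 6064, 82290, [(2, 4), (3, 19), (5, 396), (6, 601), (7, 3000), (8, 2298)]⟩,
  ⟨20, 9, 1016, 1380, [(1, 309), (2, 1520), (3, 5010), (4, 7646), (5, 9999), (9, 8753)]⟩,
  ⟨53, 21, 4126912, 249951, [(1, 1227), (2, 7542), (3, 18638), (6, 124898), (7, 2313590), (8, 5571594), (9, 10000000)]⟩,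
  ⟨66, 11, 60, 211876, [(7, 3457), (8, 5405), (9, 41281), (10, 99999)]⟩,
  ⟨74, 11, 372, 487635, [(3, 58), (6, 20963), (8, 57830), (10, 1000000)]⟩,
  ⟨40, 10, 884, 35960, [(2, 6), (4, 215), (5, 200), (7, 229), (9, 9999)]⟩,
  ⟨68, 10, 92, 178365, [(4, 93), (7, 9668), (8, 25881), (9, 99999)]⟩,
  ⟨29, 12, 2920, 3895, [(1, 2), (2, 28), (3, 12), (4, 483), (7, 1697), (8, 9999)]⟩,
  ⟨34, 11, 3824, 12650, [(3, 116), (4, 349), (5, 585), (6, 2027), (7, 3000), (9, 2918)]⟩,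
  ⟨74, 11, 60, 487635, [(7, 4), (8, 10), (9, 69), (10, 200)]⟩,
  ⟨38, 10, 1372, 12650, [(1, 228), (5, 15758), (7, 472288), (9, 1000000)]⟩,
  ⟨73, 11, 92, 316251, [(5, 1), (8, 108), (9, 261), (10, 999)]⟩,
  ⟨58, 16, 129036, 395067, [(1, 13), (2, 70), (3, 128), (13, 99999), (14, 94515)]⟩,
  ⟨50, 19, 988768, 149040, [(2, 1), (3, 5), (5, 26), (7, 70), (8, 851), (9, 3000)]⟩,
  ⟨63, 11, 1496, 292825, [(3, 11), (4, 64), (6, 18), (7, 685), (8, 9999)]⟩,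
  ⟨50, 10, 936, 66045, [(2, 15), (4, 108), (5, 77), (6, 205), (8, 9999)]⟩,
  ⟨39, 14, 29956, 17577, [(1, 48), (2, 269), (3, 657), (11, 99999)]⟩,
  ⟨39, 10, 628, 12650, [(4, 95), (6, 4), (7, 201), (9, 3000)]⟩,
  ⟨74, 9, 60, 814385, [(5, 1), (6, 7), (7, 50), (8, 200)]⟩,
  ⟨55, 10, 60, 91390, [(6, 134), (7, 185), (8, 1398), (9, 3000)]⟩,
  ⟨30, 13, 13654, 8878, [(9, 1), (12, 9)]⟩,
  ⟨52, 23, 1279520, 149040, [(1, 26), (4, 4184), (10, 1000000), (11, 53969)]⟩,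
  ⟨52, 10, 92, 40920, [(7, 95), (8, 39), (9, 400)]⟩,
  ⟨52, 9, 370, 73815, [(4, 33), (5, 12), (6, 179), (9, 3000)]⟩,
  ⟨70, 8, 440, 595665, [(1, 2), (2, 1), (4, 639), (5, 2513), (6, 9999)]⟩,
  ⟨72, 11, 1832, 316251, [(1, 65), (2, 3990), (6, 405256), (9, 10000000)]⟩,
  ⟨66, 11, 372, 367290, [(5, 18), (6, 285), (8, 376), (10, 9999)]⟩,
  ⟨72, 11, 2472, 292825, [(3, 1), (6, 18), (7, 79), (9, 999)]⟩,
  ⟨45, 10, 188, 35960, [(6, 127), (7, 25), (8, 768), (9, 999)]⟩,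
  ⟨63, 10, 114, 194580, [(5, 10077), (6, 1505), (7, 56144), (10, 1000000)]⟩,
  ⟨71, 7, 114, 424270, [(2, 3), (3, 20), (4, 86), (7, 3000)]⟩,
  ⟨71, 7, 220, 766480, [(1, 7), (2, 18), (4, 2645), (5, 18201), (6, 99999)]⟩,
  ⟨46, 23, 16747312, 149040, [(3, 320), (5, 458), (6, 250), (7, 85), (9, 22765), (10, 99999), (11, 97911)]⟩,
  ⟨73, 11, 114, 455126, [(5, 49), (6, 9558), (8, 54305), (11, 1000000)]⟩,
  ⟨70, 6, 116, 814385, [(1, 2), (2, 24), (3, 112), (5, 3000)]⟩,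
  ⟨60, 11, 1832, 292825, [(1, 4), (2, 54), (5, 122), (6, 4390), (9, 99999)]⟩,
  ⟨34, 9, 700, 10626, [(4, 72), (5, 2029), (7, 9999), (8, 8188)]⟩,
  ⟨28, 8, 348, 1380, [(3, 1), (4, 129), (5, 1310), (7, 3000)]⟩,
  ⟨32, 12, 3512, 8855, [(6, 1), (9, 3)]⟩,
  ⟨23, 7, 244, 1365, [(1, 1), (2, 3), (3, 3), (5, 24), (6, 99)]⟩,
  ⟨26, 8, 220, 3060, [(1, 1), (4, 173), (5, 344), (6, 402), (7, 999)]⟩,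
  ⟨20, 9, 476, 1015, [(3, 19), (4, 1135), (6, 2147), (7, 719), (8, 3000)]⟩,
  ⟨20, 7, 248, 1015, [(1, 4), (2, 21), (3, 61), (4, 99), (5, 78)]⟩,
  ⟨42, 9, 370, 46376, [(3, 1), (4, 52), (6, 259), (9, 3000)]⟩,
  ⟨62, 11, 372, 316251, [(3, 17), (5, 323), (6, 2407), (8, 6302), (10, 99999)]⟩,
  ⟨37, 10, 700, 23751, [(5, 9), (6, 78), (8, 400), (9, 284)]⟩,
  ⟨60, 11, 372, 292825, [(3, 2), (5, 42), (6, 248), (8, 615), (10, 9999)]⟩,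
  ⟨17, 8, 502, 728, [(1, 1), (5, 18), (6, 40), (7, 27), (8, 10)]⟩,
  ⟨55, 21, 1672800, 230350, [(1, 2), (4, 248), (5, 140), (9, 1638), (10, 99999)]⟩,
  ⟨33, 9, 626, 12650, [(3, 1898), (4, 599), (8, 75745), (9, 99999)]⟩,
  ⟨26, 7, 188, 3060, [(3, 55), (4, 58), (5, 345), (6, 400)]⟩,
  ⟨21, 6, 118, 1365, [(1, 19), (4, 22), (5, 825), (6, 999)]⟩,
  ⟨60, 11, 2140, 292825, [(1, 27), (8, 221278), (9, 109091), (10, 1000000)]⟩,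
  ⟨21, 7, 246, 2380, [(1, 22), (2, 52), (3, 12), (5, 778), (6, 2700), (7, 3000)]⟩,
  ⟨71, 9, 756, 677040, [(3, 95), (4, 397), (5, 2204), (6, 3673), (8, 99999)]⟩,
  ⟨39, 12, 7660, 66082, [(3, 55), (4, 70), (6, 73), (7, 252), (9, 9782), (10, 9999)]⟩,
  ⟨53, 10, 114, 135751, [(4, 2), (5, 41), (7, 217), (10, 3000)]⟩,
  ⟨26, 8, 444, 5985, [(3, 5), (4, 16), (5, 31), (6, 99), (7, 89)]⟩,
  ⟨28, 8, 378, 10626, [(2, 12), (3, 269), (5, 1192), (7, 1458), (8, 9999)]⟩,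
  ⟨27, 8, 444, 8855, [(3, 17), (4, 60), (5, 126), (6, 392), (7, 400)]⟩,
  ⟨70, 11, 2424, 595665, [(1, 19), (6, 54751), (7, 60358), (8, 600147), (9, 1000000)]⟩,
  ⟨65, 11, 114, 367290, [(5, 58), (6, 1135), (8, 6288), (11, 99999)]⟩,
  ⟨27, 8, 114, 3876, [(2, 7), (3, 11), (7, 306), (8, 400)]⟩,
  ⟨71, 7, 248, 766480, [(1, 99), (2, 2207), (3, 29055), (4, 235294), (5, 1000000)]⟩,
  ⟨15, 7, 252, 728, [(1, 46), (2, 153), (3, 597), (4, 555), (5, 999)]⟩,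
  ⟨35, 10, 626, 23751, [(3, 1), (4, 5), (9, 172), (10, 200)]⟩,
  ⟨19, 6, 60, 728, [(2, 171), (3, 277), (4, 999), (5, 962)]⟩,
  ⟨20, 7, 188, 2380, [(3, 5), (5, 20), (6, 5)]⟩,
  ⟨62, 11, 114, 316251, [(5, 87), (6, 1209), (8, 6706), (11, 99999)]⟩,
  ⟨50, 24, 3901024, 211925, [(1, 52), (3, 766), (4, 2993), (5, 2319), (8, 39209), (9, 395258), (10, 1000000)]⟩,
  ⟨48, 10, 370, 111930, [(4, 13), (5, 156), (7, 840), (10, 9999)]⟩,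
  ⟨49, 10, 370, 123410, [(4, 3), (5, 46), (7, 244), (10, 3000)]⟩,
  ⟨36, 10, 626, 27405, [(3, 1), (4, 9), (9, 326), (10, 400)]⟩,
  ⟨40, 10, 626, 46376, [(4, 1290), (7, 1068), (9, 61378), (10, 99999)]⟩,
  ⟨39, 10, 626, 40920, [(3, 2), (4, 45), (9, 2091), (10, 3000)]⟩,
  ⟨37, 10, 626, 31465, [(3, 2), (4, 20), (9, 773), (10, 999)]⟩,
  ⟨38, 10, 626, 35960, [(3, 12), (4, 174), (9, 7341), (10, 9999)]⟩,
  ⟨60, 11, 114, 292825, [(5, 1109), (6, 12591), (8, 70254), (11, 1000000)]⟩]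

set_option maxRecDepth 100000 in
theorem johnsonCertificates_isValid :
    johnsonCertificates.all LPCertificate.isValid = true := by
  decide +kernel

/-! ### The finite verification -/

/-- Bounded quantification over `lo ≤ k ≤ hi`, as a Boolean. -/
def allBetween (lo hi : ℕ) (p : ℕ → Bool) : Bool :=
  (List.range' lo (hi + 1 - lo)).all p

theorem of_allBetween {lo hi : ℕ} {p : ℕ → Bool} (h : allBetween lo hi p = true) {k : ℕ}
    (h1 : lo ≤ k) (h2 : k ≤ hi) : p k = true :=
  List.all_eq_true.1 h k (List.mem_range'_1.2 (by omega))

/-- The integrality conditions for the distances `a < b < c < d`. -/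
def integralDistances (a b c d : ℕ) : Bool :=
  a * b * c % ((d - a) * (d - b) * (d - c)) == 0 &&
  a * b * d % ((c - a) * (c - b) * (d - c)) == 0 &&
  a * c * d % ((b - a) * (c - b) * (d - b)) == 0 &&
  b * c * d % ((b - a) * (c - a) * (d - a)) == 0

def thirdCoeffCheck (n w s : ℕ) : Bool :=
  Nat.ble ((n - 6) * (s + 6) + 4 * ((w - 3) * (w - 3))) (4 * w * (n - 6))

/-- The first two conditions say that both padding blocks, of `C.w - w` ones and `(C.n - C.w) - (n -
w)` zeros, have nonnegative size. -/
def LPCertificate.applies (C : LPCertificate) (n w b : ℕ) : Bool :=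
  Nat.ble w C.w && Nat.ble (n + C.w) (C.n + w) && Nat.ble C.bound b

def certificatesFor (a b c d : ℕ) : List LPCertificate :=
  johnsonCertificates.filter fun C =>
    C.dists.testBit d && C.dists.testBit c && C.dists.testBit b && C.dists.testBit a

def chooseThree (n : ℕ) : ℕ := n * (n - 1) * (n - 2) / 6

def chooseFour (n : ℕ) : ℕ := n * (n - 1) * (n - 2) * (n - 3) / 24

/-- The number `h_0 + h_1 + h_2 + h_4`. -/
def johnsonBound (n : ℕ) : ℕ := chooseFour n + n * (n - 1) / 2 - chooseThree n

/-- The largest `w` for which the maximal sets with four distances in the Johnson space are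
determined. -/
def maxWeight (n : ℕ) : ℕ :=
  bif n.ble 16 then 5 else bif n.ble 19 then 6 else bif n.ble 24 then 7 else bif n.ble 29 then 8
  else bif n.ble 34 then 9 else bif n.ble 40 then 10 else bif n.ble 47 then 9
  else bif n.ble 59 then 10 else 11

def allDistances (p : ℕ → ℕ → ℕ → ℕ → Bool) (m : ℕ) : Bool :=
  allBetween 1 m fun d => allBetween 1 (d - 1) fun c => allBetween 1 (c - 1) fun b =>
    allBetween 1 (b - 1) fun a => !integralDistances a b c d || p a b c d

def generalCheck (a b c d : ℕ) : Bool :=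
  allBetween 14 58 fun n => allBetween (max 5 d) (n / 2) fun w =>
    thirdCoeffCheck n w (a + b + c + d) ||
      (certificatesFor a b c d).any fun C => C.applies n w (johnsonBound n)

/-- `d ≤ 4` forces the distances `1, 2, 3, 4` of the extremal family, which are left to
`lpCheck_anticode`. -/
def extremalCheck (a b c d : ℕ) : Bool :=
  d.ble 4 || allBetween 15 70 fun n => allBetween (max 5 d) (maxWeight n) fun w =>
    (certificatesFor a b c d).any fun C => C.applies n w (chooseFour (n - w + 4))

/-- `29` suffices because `d ≤ w ≤ n / 2` and `n ≤ 58`. -/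
theorem allDistances_generalCheck : allDistances generalCheck 29 = true := by
  decide +kernel

theorem allDistances_extremalCheck : allDistances extremalCheck 11 = true := by
  decide +kernel

def hahnDiff (n w j t : ℕ) : ℤ :=
  hahnEval j (w - t) t (n - w - t) - hahnEval j (w - 1) 1 (n - w - 1)

/-- By Cramer's rule the `3 × 3` minors with rows `t = 2, 3, 4` solve, up to sign, the equations for
a combination of four Hahn polynomials to agree at `1, 2, 3, 4`. The signs need no proof, as the
resulting weights are checked directly. -/
def hahnMinor (n w i j k : ℕ) : ℕ :=
  let e := hahnDiff n w
  (e i 2 * (e j 3 * e k 4 - e j 4 * e k 3) - e j 2 * (e i 3 * e k 4 - e i 4 * e k 3)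
    + e k 2 * (e i 3 * e j 4 - e i 4 * e j 3)).natAbs

/-- Weights at the last four Hahn polynomials for which their combination is constant on the
distances `1, 2, 3, 4`. -/
def anticodeCoeffs (n w : ℕ) : List (ℕ × ℕ) :=
  -- The indicator of the sets through `w - 4` fixed points has degree `w - 4`, so its components of
  -- higher degree vanish. Complementary slackness then suggests weights in degrees `w - 3` to `w`
  -- only.
  [(w - 3, hahnMinor n w (w - 2) (w - 1) w), (w - 2, hahnMinor n w (w - 3) (w - 1) w),
    (w - 1, hahnMinor n w (w - 3) (w - 2) w), (w, hahnMinor n w (w - 3) (w - 2) (w - 1))]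

theorem lpCheck_anticode : (allBetween 15 70 fun n => allBetween 5 (maxWeight n) fun w =>
    -- `30 = 2 + 4 + 8 + 16` marks the distances `1, 2, 3, 4`.
    lpCheck n w 30 (chooseFour (n - w + 4)) (anticodeCoeffs n w)) = true := by
  decide +kernel
-- A family above the bound thus has more than `C(n, 3)` members, as the integrality conditions
-- require.
theorem chooseThree_le_johnsonBound : (allBetween 14 58 fun n =>
    Nat.ble (chooseThree n) (johnsonBound n)) = true := by
  decide +kernel

theorem chooseThree_le_chooseFour : (allBetween 15 70 fun n => allBetween 5 (maxWeight n) fun w =>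
    Nat.ble (chooseThree n) (chooseFour (n - w + 4))) = true := by
  decide +kernel

/-! ### Bounds for set families -/

theorem integralDistances_of_card {n w : ℕ} {A : Finset (Finset (Fin n))}
    (hA : ∀ x ∈ A, x.card = w) (hw : 3 ≤ w) {a b c d : ℕ} (hab : a < b) (hbc : b < c) (hcd : c < d)
    (hD : ∀ x ∈ A, ∀ y ∈ A, x ≠ y →
      (x \ y).card = a ∨ (x \ y).card = b ∨ (x \ y).card = c ∨ (x \ y).card = d)
    (hcard : n.choose 3 < A.card) : integralDistances a b c d = true := by
  have hcard' : (Fintype.card (Fin n)).choose 3 < A.card := by simpa using hcard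
  have h1 := dvd_of_choose_three_lt_card hA hw (a := a) (b := b) (c := c) (d := d)
    (by omega) (by omega) (by omega)
    (fun x hx y hy hxy => by have := hD x hx y hy hxy; omega) hcard'
  have h2 := dvd_of_choose_three_lt_card hA hw (a := a) (b := b) (c := d) (d := c)
    (by omega) (by omega) (by omega)
    (fun x hx y hy hxy => by have := hD x hx y hy hxy; omega) hcard'
  have h3 := dvd_of_choose_three_lt_card hA hw (a := a) (b := c) (c := d) (d := b)
    (by omega) (by omega) (by omega)
    (fun x hx y hy hxy => by have := hD x hx y hy hxy; omega) hcard'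
  have h4 := dvd_of_choose_three_lt_card hA hw (a := b) (b := c) (c := d) (d := a)
    (by omega) (by omega) (by omega)
    (fun x hx y hy hxy => by have := hD x hx y hy hxy; omega) hcard'
  have e : ∀ {i j : ℕ}, i < j → ((j - i : ℕ) : ℤ) = j - i := fun h => Nat.cast_sub h.le
  simp only [integralDistances, Bool.and_eq_true, beq_iff_eq]
  refine ⟨⟨⟨?_, ?_⟩, ?_⟩, ?_⟩ <;> apply Nat.mod_eq_zero_of_dvd <;>
    rw [← Int.natCast_dvd_natCast] <;> push_cast
  · rw [e (by omega), e (by omega), e (by omega)]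
    exact h1
  -- Singling out `c` reverses one of the three differences, `b` two and `a` three; an odd number
  -- costs a sign.
  · rw [e (by omega), e (by omega), e (by omega), ← neg_dvd]
    exact (dvd_of_eq (by ring)).trans h2
  · rw [e (by omega), e (by omega), e (by omega)]
    exact (dvd_of_eq (by ring)).trans h3
  · rw [e (by omega), e (by omega), e (by omega), ← neg_dvd]
    exact (dvd_of_eq (by ring)).trans h4

theorem of_allDistances {p : ℕ → ℕ → ℕ → ℕ → Bool} {m : ℕ} (h : allDistances p m = true)
    {a b c d : ℕ} (ha : 0 < a) (hab : a < b) (hbc : b < c) (hcd : c < d) (hd : d ≤ m)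
    (hi : integralDistances a b c d = true) : p a b c d = true := by
  have h1 := of_allBetween h (show 1 ≤ d by omega) hd
  have h2 := of_allBetween h1 (show 1 ≤ c by omega) (show c ≤ d - 1 by omega)
  have h3 := of_allBetween h2 (show 1 ≤ b by omega) (show b ≤ c - 1 by omega)
  have h4 := of_allBetween h3 (show 1 ≤ a by omega) (show a ≤ b - 1 by omega)
  simpa [hi] using h4

theorem card_le_of_lpCheck {n w n' w' S b : ℕ} {A : Finset (Finset (Fin n))}
    (hA : ∀ x ∈ A, x.card = w) (hw : w ≤ w') (hn : n + w' ≤ n' + w) {l : List (ℕ × ℕ)}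
    (hb : 0 < b) (h : lpCheck n' w' S b l = true)
    (hS : ∀ x ∈ A, ∀ y ∈ A, x ≠ y → S.testBit (x \ y).card = true) : A.card ≤ b := by
  refine card_le_of_hahnSum_of_le hA hw hn l hb fun x hx y hy hxy => ?_
  have hle : (x \ y).card ≤ w' := by
    have := Finset.card_le_card (Finset.sdiff_subset (s := x) (t := y))
    rw [hA x hx] at this
    omega
  have := List.all_eq_true.1 h (x \ y).card (List.mem_range.2 (by omega))
  simpa [hS x hx y hy hxy] using this

theorem card_le_of_certificate {n w T : ℕ} {A : Finset (Finset (Fin n))}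
    (hA : ∀ x ∈ A, x.card = w) {a b c d : ℕ}
    (hD : ∀ x ∈ A, ∀ y ∈ A, x ≠ y →
      (x \ y).card = a ∨ (x \ y).card = b ∨ (x \ y).card = c ∨ (x \ y).card = d)
    (h : ((certificatesFor a b c d).any fun C => C.applies n w T) = true) : A.card ≤ T := by
  obtain ⟨C, hC, hap⟩ := List.any_eq_true.1 h
  obtain ⟨hmem, hbits⟩ := List.mem_filter.1 hC
  have hval := List.all_eq_true.1 johnsonCertificates_isValid C hmem
  simp only [LPCertificate.isValid, LPCertificate.applies, Bool.and_eq_true, Nat.ble_eq]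
    at hval hap hbits
  refine (card_le_of_lpCheck hA hap.1.1 hap.1.2 hval.1 hval.2 fun x hx y hy hxy => ?_).trans hap.2
  rcases hD x hx y hy hxy with h | h | h | h <;> rw [h] <;> tauto

theorem choose_three_eq (n : ℕ) : n.choose 3 = chooseThree n := by
  rw [Nat.choose_eq_descFactorial_div_factorial, chooseThree]
  simp only [Nat.descFactorial_succ, Nat.descFactorial_zero, Nat.factorial, Nat.sub_zero]
  congr 1
  ring

theorem choose_four_eq (n : ℕ) : n.choose 4 = chooseFour n := by
  rw [Nat.choose_eq_descFactorial_div_factorial, chooseFour]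
  simp only [Nat.descFactorial_succ, Nat.descFactorial_zero, Nat.factorial, Nat.sub_zero]
  congr 1
  ring

theorem johnsonBound_eq (n : ℕ) :
    johnsonBound n = n.choose 4 + n.choose 2 - n.choose 3 := by
  rw [johnsonBound, choose_three_eq, choose_four_eq, Nat.choose_two_right]

theorem card_le_johnsonBound {n w : ℕ} (hn : 14 ≤ n) (hn' : n ≤ 58) (hw : 5 ≤ w) (hwn : 2 * w ≤ n)
    {A : Finset (Finset (Fin n))} (hA : ∀ x ∈ A, x.card = w) {a b c d : ℕ}
    (ha : 0 < a) (hab : a < b) (hbc : b < c) (hcd : c < d) (hd : d ≤ w)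
    (hD : ∀ x ∈ A, ∀ y ∈ A, x ≠ y →
      (x \ y).card = a ∨ (x \ y).card = b ∨ (x \ y).card = c ∨ (x \ y).card = d) :
    A.card ≤ n.choose 4 + n.choose 2 - n.choose 3 := by
  by_contra! hlt
  rw [← johnsonBound_eq] at hlt
  have h3 := of_allBetween chooseThree_le_johnsonBound hn hn'
  rw [Nat.ble_eq, ← choose_three_eq] at h3
  have hi := integralDistances_of_card hA (by omega) hab hbc hcd hD (by omega)
  have hc := of_allDistances allDistances_generalCheck ha hab hbc hcd (by omega) hi
  have hc' := of_allBetween (of_allBetween hc hn hn') (k := w) (by omega) (by omega)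
  rcases Bool.or_eq_true_iff.1 hc' with h | h
  · rw [thirdCoeffCheck, Nat.ble_eq] at h
    have := card_add_choose_three_le (Fintype.card_fin n) (by omega) hA (by omega) ha
      (by omega) (by omega) (by omega) hD (by
        zify [show 6 ≤ n by omega, show 3 ≤ w by omega] at h
        linarith)
    rw [johnsonBound_eq] at hlt
    omega
  · exact absurd (card_le_of_certificate hA hD h) (by omega)

theorem card_le_choose_four {n w : ℕ} (hn : 15 ≤ n) (hn' : n ≤ 70) (hw : 5 ≤ w)
    (hwn : w ≤ maxWeight n) {A : Finset (Finset (Fin n))} (hA : ∀ x ∈ A, x.card = w)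
    {a b c d : ℕ} (ha : 0 < a) (hab : a < b) (hbc : b < c) (hcd : c < d) (hd : d ≤ w)
    (hD : ∀ x ∈ A, ∀ y ∈ A, x ≠ y →
      (x \ y).card = a ∨ (x \ y).card = b ∨ (x \ y).card = c ∨ (x \ y).card = d) :
    A.card ≤ (n - w + 4).choose 4 := by
  by_contra! hlt
  have h3 := of_allBetween (of_allBetween chooseThree_le_chooseFour hn hn') hw hwn
  rw [Nat.ble_eq, ← choose_three_eq, ← choose_four_eq] at h3
  have hmax : maxWeight n ≤ 11 := by
    simp only [maxWeight, cond_eq_ite]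
    split_ifs <;> omega
  have hi := integralDistances_of_card hA (by omega) hab hbc hcd hD (by omega)
  have hc := of_allDistances allDistances_extremalCheck ha hab hbc hcd (by omega) hi
  rcases Bool.or_eq_true_iff.1 hc with h | h
  · rw [Nat.ble_eq] at h
    have h4 := of_allBetween (of_allBetween lpCheck_anticode hn hn') hw hwn
    rw [← choose_four_eq] at h4
    refine absurd (card_le_of_lpCheck hA le_rfl le_rfl (Nat.choose_pos (by omega)) h4 ?_)
      (by omega)
    intro x hx y hy hxy
    have : (x \ y).card = 1 ∨ (x \ y).card = 2 ∨ (x \ y).card = 3 ∨ (x \ y).card = 4 := by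
      have := hD x hx y hy hxy
      omega
    rcases this with h | h | h | h <;> rw [h] <;> rfl
  · have h := of_allBetween (of_allBetween h hn hn') (k := w) (by omega) hwn
    rw [← choose_four_eq] at h
    exact absurd (card_le_of_certificate hA hD h) (by omega)

/-! ### From vectors to supports -/

/-- The support of a vector of the Johnson space. -/
def JohnsonSpace.support {n w : ℕ} (x : JohnsonSpace n w) : Finset (Fin n) :=
  Finset.univ.filter fun i => x.1 i = 1

theorem JohnsonSpace.card_support {n w : ℕ} (x : JohnsonSpace n w) : x.support.card = w := x.2

theorem zmod_two_eq_iff (a b : ZMod 2) : a = b ↔ (a = 1 ↔ b = 1) := by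
  revert a b; decide

theorem JohnsonSpace.support_injective {n w : ℕ} :
    Function.Injective (JohnsonSpace.support : JohnsonSpace n w → Finset (Fin n)) := by
  intro x y h
  refine Subtype.ext (funext fun i => (zmod_two_eq_iff _ _).2 ?_)
  have := congrArg (i ∈ ·) h
  simpa [JohnsonSpace.support] using this

/-- Supports of equal size have differences of equal size, so the Hamming distance is twice `|x \
y|`. -/
theorem JohnsonSpace.dist_eq {n w : ℕ} (x y : JohnsonSpace n w) :
    dist x y = ((x.support \ y.support).card : ℝ) := by
  have h1 : hammingDist x.1 y.1 = (x.support \ y.support ∪ y.support \ x.support).card := by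
    rw [hammingDist]
    congr 1
    ext i
    have := zmod_two_eq_iff (x.1 i) (y.1 i)
    simp only [Finset.mem_filter, Finset.mem_univ, true_and, Finset.mem_union, Finset.mem_sdiff,
      JohnsonSpace.support]
    tauto
  have h2 : (y.support \ x.support).card = (x.support \ y.support).card :=
    Finset.card_sdiff_comm (y.card_support.trans x.card_support.symm)
  rw [Finset.card_union_of_disjoint
    (Finset.disjoint_of_subset_right Finset.sdiff_subset Finset.sdiff_disjoint), h2] at h1
  have h3 : dist x y = (hammingDist x.1 y.1 : ℝ) / 2 := rfl
  rw [h3, h1]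
  push_cast
  ring

/-- The vector of the Johnson space with a given support. -/
def JohnsonSpace.ofSupport {n w : ℕ} (S : Finset (Fin n)) (hS : S.card = w) : JohnsonSpace n w :=
  ⟨fun i => if i ∈ S then 1 else 0, by simpa using hS⟩

theorem JohnsonSpace.support_ofSupport {n w : ℕ} (S : Finset (Fin n)) (hS : S.card = w) :
    (JohnsonSpace.ofSupport S hS).support = S := by
  ext i
  simp [JohnsonSpace.ofSupport, JohnsonSpace.support]

theorem maxSDistance_le {M : Type*} [MetricSpace M] {s B : ℕ}
    (h : ∀ X : Finset M, IsSDistanceSet s X → X.card ≤ B) : maxSDistance M s ≤ B :=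
  csSup_le' (by rintro k ⟨X, hX, rfl⟩; exact h X hX)

theorem IsSDistanceSet.exists_distances {n w : ℕ} {X : Finset (JohnsonSpace n w)}
    (hX : IsSDistanceSet 4 X) :
    ∃ a b c d : ℕ, 0 < a ∧ a < b ∧ b < c ∧ c < d ∧ d ≤ w ∧
      ∀ x ∈ X.map ⟨JohnsonSpace.support, JohnsonSpace.support_injective⟩,
      ∀ y ∈ X.map ⟨JohnsonSpace.support, JohnsonSpace.support_injective⟩, x ≠ y →
        (x \ y).card = a ∨ (x \ y).card = b ∨ (x \ y).card = c ∨ (x \ y).card = d := by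
  classical
  let D : Finset ℕ := X.offDiag.image fun p => (p.1.support \ p.2.support).card
  have hD : distanceSet X = ((↑) : ℕ → ℝ) '' D := by
    ext t
    simp only [distanceSet, Set.mem_ofPred_eq, D, Finset.coe_image, Set.image_image, Set.mem_image,
      Finset.mem_coe, Finset.mem_offDiag, Prod.exists, JohnsonSpace.dist_eq]
    constructor
    · rintro ⟨x, hx, y, hy, hxy, h⟩; exact ⟨x, y, ⟨hx, hy, hxy⟩, h⟩
    · rintro ⟨x, y, ⟨hx, hy, hxy⟩, h⟩; exact ⟨x, hx, y, hy, hxy, h⟩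
  have hcard : D.card = 4 := by
    have h : (distanceSet X).ncard = 4 := hX
    rwa [hD, Set.ncard_image_of_injective _ Nat.cast_injective, Set.ncard_coe_finset] at h
  have hmem : ∀ t ∈ D, 0 < t ∧ t ≤ w := by
    intro t ht
    obtain ⟨⟨x, y⟩, hp, rfl⟩ := Finset.mem_image.1 ht
    have hxy := (Finset.mem_offDiag.1 hp).2.2
    constructor
    · rw [Finset.card_pos, Finset.sdiff_nonempty]
      intro hsub
      exact hxy (JohnsonSpace.support_injective (Finset.eq_of_subset_of_card_le hsub
        (y.card_support.trans x.card_support.symm).le))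
    · exact (Finset.card_le_card Finset.sdiff_subset).trans x.card_support.le
  let e := D.orderEmbOfFin hcard
  have hmono : ∀ i j : Fin 4, i < j → e i < e j := fun i j h => e.strictMono h
  have he : ∀ t ∈ D, t = e 0 ∨ t = e 1 ∨ t = e 2 ∨ t = e 3 := by
    intro t ht
    have : t ∈ Set.range e := by rw [Finset.range_orderEmbOfFin]; exact ht
    obtain ⟨i, rfl⟩ := this
    fin_cases i <;> simp
  refine ⟨e 0, e 1, e 2, e 3, (hmem _ (D.orderEmbOfFin_mem hcard 0)).1, hmono 0 1 (by decide),
    hmono 1 2 (by decide), hmono 2 3 (by decide), (hmem _ (D.orderEmbOfFin_mem hcard 3)).2, ?_⟩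
  intro x' hx' y' hy' hxy
  obtain ⟨x, hx, rfl⟩ := Finset.mem_map.1 hx'
  obtain ⟨y, hy, rfl⟩ := Finset.mem_map.1 hy'
  refine he _ (Finset.mem_image.2 ⟨(x, y), Finset.mem_offDiag.2 ⟨hx, hy, ?_⟩, rfl⟩)
  exact fun h => hxy (congrArg JohnsonSpace.support h)

theorem card_of_mem_map_support {n w : ℕ} {X : Finset (JohnsonSpace n w)} :
    ∀ x ∈ X.map ⟨JohnsonSpace.support, JohnsonSpace.support_injective⟩, x.card = w := by
  intro x hx
  obtain ⟨y, _, rfl⟩ := Finset.mem_map.1 hx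
  exact y.card_support

/-! ### The extremal family and the theorem -/

/-- The sets that contain `w - 4` fixed points form a set with four distances. -/
theorem exists_isSDistanceSet_four {n w : ℕ} (hw : 4 ≤ w) (hwn : w + 4 ≤ n) :
    ∃ X : Finset (JohnsonSpace n w), IsSDistanceSet 4 X ∧ X.card = (n - w + 4).choose 4 := by
  classical
  obtain ⟨T, -, hT⟩ := Finset.exists_subset_card_eq (s := (Finset.univ : Finset (Fin n)))
    (n := w - 4) (by simp; omega)
  have hTc : Tᶜ.card = n - w + 4 := by rw [Finset.card_compl, Fintype.card_fin, hT]; omega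
  have hdisj : ∀ P ∈ Tᶜ.powersetCard 4, Disjoint T P := fun P hP =>
    (Finset.subset_compl_iff_disjoint_left).1 (Finset.mem_powersetCard.1 hP).1
  have hcard : ∀ P ∈ Tᶜ.powersetCard 4, (T ∪ P).card = w := fun P hP => by
    rw [Finset.card_union_of_disjoint (hdisj P hP), hT, (Finset.mem_powersetCard.1 hP).2]
    omega
  have hsd : ∀ P ∈ Tᶜ.powersetCard 4, ∀ Q : Finset (Fin n), (T ∪ P) \ (T ∪ Q) = P \ Q := by
    intro P hP Q
    have := Finset.disjoint_left.1 (hdisj P hP)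
    ext i
    have := @this i
    simp only [Finset.mem_sdiff, Finset.mem_union]
    tauto
  let f : Tᶜ.powersetCard 4 → JohnsonSpace n w := fun P =>
    JohnsonSpace.ofSupport (T ∪ P) (hcard P P.2)
  have hdist : ∀ P Q, dist (f P) (f Q) = (((P : Finset (Fin n)) \ Q).card : ℝ) := fun P Q => by
    rw [JohnsonSpace.dist_eq, JohnsonSpace.support_ofSupport, JohnsonSpace.support_ofSupport,
      hsd P P.2]
  have hcardP : ∀ P : Tᶜ.powersetCard 4, (P : Finset (Fin n)).card = 4 := fun P =>
    (Finset.mem_powersetCard.1 P.2).2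
  have hpos : ∀ P Q : Tᶜ.powersetCard 4, P ≠ Q → 0 < ((P : Finset (Fin n)) \ Q).card := by
    intro P Q hPQ
    rw [Finset.card_pos, Finset.sdiff_nonempty]
    intro hsub
    exact hPQ (Subtype.ext (Finset.eq_of_subset_of_card_le hsub (by rw [hcardP, hcardP])))
  have hf : Function.Injective f := by
    intro P Q h
    by_contra hPQ
    have h0 := hdist P Q
    rw [h, dist_self] at h0
    exact (hpos P Q hPQ).ne (by exact_mod_cast h0)
  refine ⟨Finset.univ.map ⟨f, hf⟩, ?_, ?_⟩
  · have : distanceSet (Finset.univ.map ⟨f, hf⟩)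
        = ((↑) : ℕ → ℝ) '' ((Finset.Icc 1 4 : Finset ℕ) : Set ℕ) := by
      ext t
      constructor
      · rintro ⟨x, hx, y, hy, hxy, rfl⟩
        obtain ⟨P, _, rfl⟩ := Finset.mem_map.1 hx
        obtain ⟨Q, _, rfl⟩ := Finset.mem_map.1 hy
        refine ⟨_, Finset.mem_coe.2 (Finset.mem_Icc.2 ⟨hpos P Q ?_, ?_⟩), (hdist P Q).symm⟩
        · rintro rfl; exact hxy rfl
        · exact (Finset.card_le_card Finset.sdiff_subset).trans (hcardP P).le
      · rintro ⟨k, hk, rfl⟩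
        obtain ⟨hk1, hk4⟩ := Finset.mem_Icc.1 (Finset.mem_coe.1 hk)
        obtain ⟨P, hP⟩ := Finset.powersetCard_nonempty.2 (show 4 ≤ Tᶜ.card by omega)
        obtain ⟨hPT, hP4⟩ := Finset.mem_powersetCard.1 hP
        -- Distance `k` is realized by exchanging `k` points of `P` for `k` of the `n - w ≥ 4`
        -- points of `Tᶜ \ P`.
        obtain ⟨Q, hQ, hQk⟩ := Finset.exists_subset_card_eq (s := Tᶜ \ P) (n := k) (by
          rw [Finset.card_sdiff_of_subset hPT]; omega)
        obtain ⟨R, hR, hRk⟩ := Finset.exists_subset_card_eq (s := P) (n := 4 - k) (by omega)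
        have hPQ : Disjoint P Q :=
          Finset.disjoint_of_subset_right hQ Finset.disjoint_sdiff
        have hRQ : R ∪ Q ∈ Tᶜ.powersetCard 4 := by
          rw [Finset.mem_powersetCard, Finset.card_union_of_disjoint
            (Finset.disjoint_of_subset_left hR hPQ), hQk, hRk]
          exact ⟨Finset.union_subset (hR.trans hPT) (hQ.trans Finset.sdiff_subset), by omega⟩
        have hk' : (P \ (R ∪ Q)).card = k := by
          have : P \ (R ∪ Q) = P \ R := by
            have := Finset.disjoint_left.1 hPQ
            ext i
            have := @this i
            simp only [Finset.mem_sdiff, Finset.mem_union]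
            tauto
          rw [this, Finset.card_sdiff_of_subset hR, hP4, hRk]
          omega
        refine ⟨f ⟨P, hP⟩, by simp, f ⟨R ∪ Q, hRQ⟩, by simp, ?_, ?_⟩
        · intro h
          have h0 := hdist ⟨P, hP⟩ ⟨R ∪ Q, hRQ⟩
          rw [h, dist_self] at h0
          have : (P \ (R ∪ Q)).card = 0 := by exact_mod_cast h0.symm
          omega
        · rw [hdist, hk']
    rw [IsSDistanceSet, this, Set.ncard_image_of_injective _ Nat.cast_injective,
      Set.ncard_coe_finset, Nat.card_Icc]
  · simp [hTc]

theorem theorem3p6 :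
    (∀ n w : ℕ, 14 ≤ n → n ≤ 58 → 5 ≤ w → 2 * w ≤ n →
      (maxSDistance (JohnsonSpace n w) 4 : ℤ)
          ≤ johnsonH n 0 + johnsonH n 1 + johnsonH n 2 + johnsonH n 4 ∧
        johnsonH n 0 + johnsonH n 1 + johnsonH n 2 + johnsonH n 4
          = (n.choose 4 : ℤ) - (n.choose 3 : ℤ) + (n.choose 2 : ℤ)) ∧
    (∀ n w : ℕ,
      ((15 ≤ n ∧ n ≤ 16) ∧ w = 5) ∨
      ((17 ≤ n ∧ n ≤ 19) ∧ (5 ≤ w ∧ w ≤ 6)) ∨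
      ((20 ≤ n ∧ n ≤ 24) ∧ (5 ≤ w ∧ w ≤ 7)) ∨
      ((25 ≤ n ∧ n ≤ 29) ∧ (5 ≤ w ∧ w ≤ 8)) ∨
      (((30 ≤ n ∧ n ≤ 34) ∨ (41 ≤ n ∧ n ≤ 47)) ∧ (5 ≤ w ∧ w ≤ 9)) ∨
      (((35 ≤ n ∧ n ≤ 40) ∨ (48 ≤ n ∧ n ≤ 59)) ∧ (5 ≤ w ∧ w ≤ 10)) ∨
      ((60 ≤ n ∧ n ≤ 70) ∧ (5 ≤ w ∧ w ≤ 11)) →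
      maxSDistance (JohnsonSpace n w) 4 = (n - w + 4).choose 4) := by
  constructor
  · intro n w hn hn' hw hwn
    have hH : johnsonH n 0 + johnsonH n 1 + johnsonH n 2 + johnsonH n 4
        = (n.choose 4 : ℤ) - (n.choose 3 : ℤ) + (n.choose 2 : ℤ) := by
      simp only [johnsonH, zero_add, Nat.choose_zero_right, Nat.reduceAdd]
      push_cast
      ring
    refine ⟨?_, hH⟩
    have h := maxSDistance_le (M := JohnsonSpace n w) (s := 4)
      (B := n.choose 4 + n.choose 2 - n.choose 3) fun X hX => by
        obtain ⟨a, b, c, d, ha, hab, hbc, hcd, hd, hD⟩ := hX.exists_distances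
        rw [← Finset.card_map ⟨JohnsonSpace.support, JohnsonSpace.support_injective⟩]
        exact card_le_johnsonBound hn hn' hw hwn card_of_mem_map_support ha hab hbc hcd hd hD
    have h3 := of_allBetween chooseThree_le_johnsonBound hn hn'
    rw [Nat.ble_eq, ← choose_three_eq, johnsonBound_eq] at h3
    -- With `h3` this gives `C(n, 3) < C(n, 4) + C(n, 2)`, so the subtraction in `ℕ` is not
    -- truncated.
    have h4 : 0 < n.choose 3 := Nat.choose_pos (by omega)
    rw [hH]
    omega
  · intro n w h
    have hn : 15 ≤ n := by omega
    have hn' : n ≤ 70 := by omega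
    have hw : 5 ≤ w := by omega
    have hwn : w ≤ maxWeight n := by
      simp only [maxWeight, cond_eq_ite, Nat.ble_eq]
      split_ifs <;> omega
    refine le_antisymm (maxSDistance_le fun X hX => ?_) ?_
    · obtain ⟨a, b, c, d, ha, hab, hbc, hcd, hd, hD⟩ := hX.exists_distances
      rw [← Finset.card_map ⟨JohnsonSpace.support, JohnsonSpace.support_injective⟩]
      exact card_le_choose_four hn hn' hw hwn card_of_mem_map_support ha hab hbc hcd hd hD
    · obtain ⟨X, hX, hcard⟩ := exists_isSDistanceSet_four (n := n) (w := w) (by omega) (by omega)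
      rw [← hcard]
      exact (isGreatest_maxSDistance ⟨X, hX⟩).2 ⟨X, hX, rfl⟩
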